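/- **Setting.** For $w=(W,b)\in M_{2,6}(\mathbb R)\times\mathbb R^6\cong\mathbb R^{18}$, with columns $W_1,\dots,W_6\in\mathbb R^2$ of $W$ and biases $b_1,\dots,b_6$, the TMS potential with $c=6$ features and two hidden dimensions is $H(w)=\sum_{i=1}^6 H_i(w)$, where $H_i=H_i^-$ if $b_i\le 0$ and $H_i=H_i^+$ if $b_i>0$, with $$H_i^-=\sum_{j\ne i}\delta(P_{i,j})\frac{(W_i\cdot W_j+b_i)^3}{W_i\cdot W_j}+\delta(P_i)\Big[\frac{b_i^3}{\|W_i\|^4}+\frac{b_i^3}{\|W_i\|^2}+N_i\Big]+(1-\delta(P_i)),$$ $$H_i^+=\sum_{j\ne i}\delta(Q_{i,j})\Big[-\frac{b_i^3}{W_i\cdot W_j}\Big]+\sum_{j\ne i}(1-\delta(Q_{i,j}))\big[(W_i\cdot W_j)^2+3(W_i\cdot W_j)b_i+3b_i^2\big]+N_i,$$ $N_i=(1-\|W_i\|^2)^2-3(1-\|W_i\|^2)b_i+3b_i^2$. Here $\delta(\cdot)\in\{0,1\}$ is the indicator of the conditions $P_{i,j}$: $W_i\cdot W_j>0$ and $-W_i\cdot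 W_j\le b_i\le 0$; $P_i$: $\|W_i\|^2>0$ and $-\|W_i\|^2\le b_i\le 0$; $Q_{i,j}$: $-W_i\cdot W_j>b_i>0$. Write $\kappa=\cos(2\pi/5)$ and consider the conditions on $(x,y)\in\mathbb R^2$: $$x>0,\qquad y\le 0,\qquad -x^2\kappa\le y,$$ $$x^6(1+2\kappa)+x^2y^2\big(1+\tfrac2\kappa\big)+6x^4y+y^2-x^4=0,$$ $$2x^8(1+2\kappa^2)+3x^6y(1+2\kappa)-x^2y^3\big(1+\tfrac2\kappa\big)-2x^6-2y^3=0 .$$ A point $w=(W,b)$ is a $5^+$-gon for $(x,y)$ if for some angle $\varphi$ one has $W_k=x\big(\cos(\varphi+\tfrac{2\pi (k-1)}5),\sin(\varphi+\tfrac{2\pi (k-1)}5)\big)$ and $b_k=y$ for $k=1,\dots,5$, and $W_6=0$, $b_6=\tfrac1{12}$. A function $f$ on $\mathbb R^n$ is *minimally singular* at $w$ if on some open neighbourhood $U$ of $w$ there are smooth coordinates $u_1,\dots,u_n$ centred at $w$, a proper subset $S\subsetneq\{1,\dots,n\}$ and constants $a_i>0$ such that $f=f(w)+\sum_{i\in S}a_iu_i^2$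 on $U$. The number $\lambda$ is the *local learning coefficient* of $f$ at $w$ if $w$ is a local minimum of $f$ and there is an integer $m\ge1$ such that for every sufficiently small $\rho>0$ there is a $C>0$ with $$\operatorname{vol}\{v:\|v-w\|\le\rho,\ f(v)-f(w)<\varepsilon\}\sim C\,\varepsilon^{\lambda}(-\log\varepsilon)^{m-1}\qquad(\varepsilon\to0^+).$$ **Statement.** There is exactly one pair $(l,b)$ satisfying the above conditions on $(x,y)$, and it satisfies $|l-1.17046|<5\cdot10^{-6}$ and $|b-(-0.28230)|<5\cdot10^{-6}$. Every $5^+$-gon $w$ for this pair has the following properties: 1. $w$ is a critical point of $H$, i.e. $H$ is differentiable at $w$ and $\nabla H(w)=0$; 2. $H$ is minimally singular at $w$; 3. $H$ is twice continuously differentiable near $w$; all eigenvalues of its $18\times18$ Hessian matrix at $w$ are nonnegative, exactly one of them (counted with multiplicity) is zero, and the kernel of the Hessian is spanned by the tangent vector at $w$ of the orbit of $w$ under the rotations $(W,b)\mapsto(R_tW,b)$; 4. the local learning coefficient of $H$ at $w$ is $17/2=8.5$. -/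

import Mathlib

open Real Filter Topology MeasureTheory
open scoped ContDiff

noncomputable section

namespace TMS

/-! ## The parameter space and the TMS potential -/

/-- The parameter space `M_{r,c}(ℝ) × ℝ^c` of pairs `w = (W, b)`, with its Euclidean structure and
Lebesgue measure: `w (Sum.inl (a, i))` is the matrix entry `W a i` and `w (Sum.inr i)` is the
bias `b i`. -/
abbrev Param (r c : ℕ) : Type := EuclideanSpace ℝ ((Fin r × Fin c) ⊕ Fin c)

variable {r c : ℕ}

/-- The entry `W a i` of the weight matrix. -/
def weight (w : Param r c) (a : Fin r) (i : Fin c) : ℝ := w (Sum.inl (a, i))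

/-- The bias `b i`. -/
def bias (w : Param r c) (i : Fin c) : ℝ := w (Sum.inr i)

/-- The dot product `W_i ⬝ W_j` of two columns of the weight matrix; `colDot w i i = ‖W_i‖²`. -/
def colDot (w : Param r c) (i j : Fin c) : ℝ := ∑ a, weight w a i * weight w a j

/-- Membership in `P_{i,j}`. -/
def InPij (w : Param r c) (i j : Fin c) : Prop :=
  0 < colDot w i j ∧ -colDot w i j ≤ bias w i ∧ bias w i ≤ 0

/-- Membership in `P_i`. -/
def InPi (w : Param r c) (i : Fin c) : Prop :=
  0 < colDot w i i ∧ -colDot w i i ≤ bias w i ∧ bias w i ≤ 0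

/-- Membership in `Q_{i,j}`. -/
def InQij (w : Param r c) (i j : Fin c) : Prop :=
  bias w i < -colDot w i j ∧ 0 < bias w i

/-- `N_i = (1 - ‖W_i‖²)² - 3 (1 - ‖W_i‖²) b_i + 3 b_i²`. -/
def selfTerm (w : Param r c) (i : Fin c) : ℝ :=
  (1 - colDot w i i) ^ 2 - 3 * (1 - colDot w i i) * bias w i + 3 * bias w i ^ 2

open Classical in
/-- The contribution `H_i^-` of an index with non-positive bias. -/
def potentialNeg (w : Param r c) (i : Fin c) : ℝ :=
  (∑ j ∈ Finset.univ.erase i,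
      if InPij w i j then 1 / colDot w i j * (colDot w i j + bias w i) ^ 3 else 0) +
    if InPi w i then
      bias w i ^ 3 / colDot w i i ^ 2 + bias w i ^ 3 / colDot w i i + selfTerm w i
    else 1

open Classical in
/-- The contribution `H_i^+` of an index with positive bias. -/
def potentialPos (w : Param r c) (i : Fin c) : ℝ :=
  (∑ j ∈ Finset.univ.erase i,
      if InQij w i j then -(1 / colDot w i j) * bias w i ^ 3
      else colDot w i j ^ 2 + 3 * colDot w i j * bias w i + 3 * bias w i ^ 2) +
    selfTerm w i

/-- The TMS potential `H(W, b)` (which is `3c` times the population loss). -/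
def potential (w : Param r c) : ℝ :=
  ∑ i, if bias w i ≤ 0 then potentialNeg w i else potentialPos w i

/-! ## The `5⁺`-gon -/

/-- The equations satisfied by the length `x` and the bias `y` of the standard `5`-gon: `x > 0`,
`y ≤ 0`, the inequality `-x² cos (2π/5) ≤ y` that says which terms of the potential are
active, and vanishing of the derivatives of the potential with respect to a bias and to a length
(after clearing denominators). -/
structure IsPentagonSolution (x y : ℝ) : Prop where
  pos : 0 < x
  nonpos : y ≤ 0
  chamber : -x ^ 2 * cos (2 * π / 5) ≤ y
  bias_eq : x ^ 6 * (1 + 2 * cos (2 * π / 5)) + x ^ 2 * y ^ 2 * (1 + 2 / cos (2 * π / 5))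
    + 2 * x ^ 4 * y * 3 + y ^ 2 - x ^ 4 = 0
  length_eq : 2 * x ^ 8 * (1 + 2 * cos (2 * π / 5) ^ 2) + 3 * x ^ 6 * y * (1 + 2 * cos (2 * π / 5))
    - x ^ 2 * y ^ 3 * (1 + 2 / cos (2 * π / 5)) - 2 * x ^ 6 - 2 * y ^ 3 = 0

/-- `w` has five columns of length `x`, in anticlockwise order with consecutive angles `2π/5`
(starting at an arbitrary angle `φ`) and with bias `y`; its sixth column is zero with bias `1/12`,
that is, `1/(2c)` for `c = 6`. -/
def IsFivePlusGon (x y : ℝ) (w : Param 2 6) : Prop :=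
  (∃ φ : ℝ, ∀ k : Fin 5,
      weight w 0 k.castSucc = x * cos (φ + 2 * π * (k : ℝ) / 5) ∧
      weight w 1 k.castSucc = x * sin (φ + 2 * π * (k : ℝ) / 5)) ∧
  (∀ a, weight w a (Fin.last 5) = 0) ∧
  (∀ k : Fin 5, bias w k.castSucc = y) ∧
  bias w (Fin.last 5) = 1 / 12

/-! ## Hessian, minimal singularity and local learning coefficient -/

section General

variable {ι : Type*} [Fintype ι] [DecidableEq ι]

/-- The Hessian matrix of `f` at `w` in the standard coordinates. -/
def hessian (f : EuclideanSpace ℝ ι → ℝ) (w : EuclideanSpace ℝ ι) : Matrix ι ι ℝ :=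
  Matrix.of fun i j =>
    fderiv ℝ (fderiv ℝ f) w (EuclideanSpace.single i 1) (EuclideanSpace.single j 1)

/-- `f` is minimally singular at `w`: on an open neighbourhood of `w` there are smooth local
coordinates centred at `w` in which `f - f w` is a sum of squares with positive coefficients of
some, but not all, of the coordinates. -/
def IsMinimallySingularAt (f : EuclideanSpace ℝ ι → ℝ) (w : EuclideanSpace ℝ ι) : Prop :=
  ∃ e : OpenPartialHomeomorph (EuclideanSpace ℝ ι) (EuclideanSpace ℝ ι),
    w ∈ e.source ∧ e w = 0 ∧ ContDiffOn ℝ ∞ e e.source ∧ ContDiffOn ℝ ∞ e.symm e.target ∧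
    ∃ (S : Finset ι) (a : ι → ℝ), S ≠ Finset.univ ∧ (∀ i ∈ S, 0 < a i) ∧
      ∀ x ∈ e.source, f x = f w + ∑ i ∈ S, a i * (e x i) ^ 2

/-- The volume of the part of the closed ball of radius `ρ` around `w` where `f < f w + ε`. -/
def sublevelVolume (f : EuclideanSpace ℝ ι → ℝ) (w : EuclideanSpace ℝ ι) (ρ ε : ℝ) : ℝ :=
  volume.real {x ∈ Metric.closedBall w ρ | f x - f w < ε}

/-- `lam` is the local learning coefficient of `f` at the local minimum `w`: for all sufficiently
small balls around `w`, the volume of the set where `f < f w + ε` is asymptotic, as `ε → 0⁺`, to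
`C ε ^ lam (-log ε) ^ (m - 1)` for some `C > 0`, with `m ≥ 1` the multiplicity (here
`m = k + 1`). -/
structure HasLocalLearningCoefficient (f : EuclideanSpace ℝ ι → ℝ) (w : EuclideanSpace ℝ ι)
    (lam : ℝ) : Prop where
  isLocalMin : IsLocalMin f w
  volume_asymptotics : ∃ k : ℕ, ∀ᶠ ρ in 𝓝[>] (0 : ℝ), ∃ C : ℝ, 0 < C ∧
    Tendsto (fun ε : ℝ => sublevelVolume f w ρ ε / (ε ^ lam * (-log ε) ^ k)) (𝓝[>] 0) (𝓝 C)

end General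

/-- The tangent vector at `w` of the orbit of `w` under rotations: the derivative at `t = 0` of
`(R_t W, b)`, where `R_t` is the rotation of the plane by the angle `t`. -/
def rotationTangent (w : Param 2 c) : Param 2 c :=
  WithLp.toLp 2 (Sum.elim (fun p => ![-weight w 1 p.2, weight w 0 p.2] p.1) (fun _ => 0))

end TMS

end

/-!
Near a `5⁺`-gon the combinatorics of the potential is constant: only neighbouring columns of the
pentagon interact and the sixth column is inert, so `potential` coincides with the smooth function
`localPotential` (`InPentagonChamber.potential_eventuallyEq`).

The length and bias equations become linear in `x²` after the substitution `y = -t x²`. Eliminating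
`x²` leaves the quartic `ratioPoly` in `t`, which has exactly one root in `[0, cos (2π/5)]`. This
gives existence, uniqueness and the numerical bounds, and an enclosure of the root that is fine
enough for the positivity below (`IsPentagonSolution.ratio`).

The two equations say exactly that the first-order term of the potential vanishes along every line
through the `5⁺`-gon. Its second-order term (`IsFramedGon.hasTwoJet`) is computed in coordinates
that rotate with the pentagon. Modulo terms that telescope around the pentagon it is a sum over the
five edges of a form in four variables and a form in three variables, the parts symmetric and
antisymmetric under reversing the edge (`hessianForm_eq_sum_edgeForms`). Both forms are positive
definite, by completing squares with approximate coefficients (`EdgeFormBounds.hessianForm_ge`).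
The tangential displacements enter only through their differences along edges, so the kernel of the
Hessian is the common tangential displacement, that is, the tangent of the rotation orbit.

The rest holds for every function with a one-parameter symmetry whose Hessian at a critical point is
nonnegative and degenerate only along the orbit (`structure_of_degenerate_only_along_orbit`). The
Morse lemma on a slice transverse to the orbit, transported by the flow, gives a smooth chart in
which the function is a constant plus the sum of the squares of all coordinates but one
(`exists_chart_eq_sum_sq`). This is minimal singularity. For the learning coefficient, rescaling the
squared coordinates by `√ε` turns the sublevel volume into `ε ^ ((n - 1) / 2)` times an integral
which converges, by dominated convergence, to the positive integral of the Jacobian over the minimal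
curve (`hasLocalLearningCoefficient_of_chart`). The limit of the domains is unproblematic because
the curve meets the sphere bounding the ball at countably many parameters only
(`eventually_countable_sphere`). The dimension is `18`, whence `17 / 2`.
-/

namespace TMS

/-! ### Smooth charts from the inverse function theorem -/

section Chart

variable {E F : Type*} [NormedAddCommGroup E] [NormedSpace ℝ E] [NormedAddCommGroup F]
  [NormedSpace ℝ F]

/-- The inverse function theorem for a function smooth near `a`. The chart may be taken inside any
neighbourhood of `a` and is smooth in both directions on all of its domain, not just at `a`. -/
theorem exists_smooth_chart [CompleteSpace E] {f : E → F} {a : E} {f' : E ≃L[ℝ] F}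
    (hf : ∀ᶠ x in 𝓝 a, ContDiffAt ℝ ∞ f x) (hf' : HasFDerivAt f (f' : E →L[ℝ] F) a)
    {U : Set E} (hU : U ∈ 𝓝 a) :
    ∃ e : OpenPartialHomeomorph E F, a ∈ e.source ∧ e.source ⊆ U ∧ (∀ x, e x = f x) ∧
      ContDiffOn ℝ ∞ e e.source ∧ ContDiffOn ℝ ∞ e.symm e.target := by
  have ha : ContDiffAt ℝ ∞ f a := hf.self_of_nhds
  set e₀ := ha.toOpenPartialHomeomorph f hf' (by simp) with he₀
  have hinv : ∀ᶠ x in 𝓝 a, ∃ g : E ≃L[ℝ] F, (g : E →L[ℝ] F) = fderiv ℝ f x := by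
    have h1 := f'.nhds
    rw [← hf'.fderiv] at h1
    exact (ha.continuousAt_fderiv (by simp)).preimage_mem_nhds h1
  obtain ⟨s, hs, hso, has⟩ := mem_nhds_iff.1 (inter_mem (inter_mem hf hinv) hU)
  have hcoe : ∀ x, (e₀.restrOpen s hso) x = f x := fun x => rfl
  refine ⟨e₀.restrOpen s hso, ⟨ha.mem_toOpenPartialHomeomorph_source hf' (by simp), has⟩,
    fun x hx => (hs hx.2).2, hcoe,
    fun x hx => ContDiffAt.contDiffWithinAt (n := ∞) (hs hx.2).1.1, fun y hy => ?_⟩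
  have hx := (e₀.restrOpen s hso).map_target hy
  obtain ⟨⟨h1, g, hg⟩, -⟩ := hs hx.2
  have h1 : ContDiffAt ℝ ∞ f _ := h1
  refine ((e₀.restrOpen s hso).contDiffAt_symm hy (f₀' := g) ?_ h1).contDiffWithinAt
  rw [hg]
  exact (h1.differentiableAt (by simp)).hasFDerivAt

end Chart

/-! ### Averages over segments -/

section Parametric

variable {E : Type} [NormedAddCommGroup E] [NormedSpace ℝ E]

theorem smul_mem_ball_zero {r t : ℝ} (ht : t ∈ Set.Icc (0 : ℝ) 1) {x : E}
    (hx : x ∈ Metric.ball (0 : E) r) : t • x ∈ Metric.ball (0 : E) r := by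
  rw [mem_ball_zero_iff] at *
  rw [norm_smul, Real.norm_of_nonneg ht.1]
  nlinarith [ht.1, ht.2, norm_nonneg x]

theorem continuousOn_comp_smul {V : Type*} [TopologicalSpace V] {G : E → V} {r : ℝ}
    (hG : ContinuousOn G (Metric.ball 0 r)) :
    ContinuousOn (fun p : ℝ × E => G (p.1 • p.2)) (Set.Icc 0 1 ×ˢ Metric.ball 0 r) :=
  hG.comp (by fun_prop) fun _ hp => smul_mem_ball_zero hp.1 hp.2

theorem hasFDerivAt_integral_pow_smul_comp_smul [FiniteDimensional ℝ E] {V : Type*}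
    [NormedAddCommGroup V] [NormedSpace ℝ V] [CompleteSpace V] (k : ℕ) {G : E → V} {r : ℝ}
    (hG : ContDiffOn ℝ 1 G (Metric.ball 0 r)) {x : E} (hx : x ∈ Metric.ball (0 : E) r) :
    HasFDerivAt (fun x => ∫ t in (0 : ℝ)..1, t ^ k • G (t • x))
      (∫ t in (0 : ℝ)..1, t ^ (k + 1) • fderiv ℝ G (t • x)) x := by
  have hcont : ∀ {W : Type _} [NormedAddCommGroup W] [NormedSpace ℝ W] (j : ℕ) {K : E → W},
      ContinuousOn K (Metric.ball 0 r) → ∀ y ∈ Metric.ball (0 : E) r,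
        ContinuousOn (fun t : ℝ => t ^ j • K (t • y)) (Set.Icc 0 1) := by
    intro W _ _ j K hK y hy
    exact (continuous_pow j).continuousOn.smul
      ((continuousOn_comp_smul hK).comp (f := fun t : ℝ => (t, y)) (by fun_prop)
        fun t ht => ⟨ht, hy⟩)
  have hG' : ContinuousOn (fderiv ℝ G) (Metric.ball 0 r) :=
    hG.continuousOn_fderiv_of_isOpen Metric.isOpen_ball le_rfl
  have hGc : ContinuousOn G (Metric.ball 0 r) := hG.continuousOn
  obtain ⟨δ, hδ, hδr⟩ := Metric.nhds_basis_closedBall.mem_iff.1 (Metric.isOpen_ball.mem_nhds hx)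
  have hK : IsCompact (Set.Icc (0 : ℝ) 1 ×ˢ Metric.closedBall x δ) :=
    isCompact_Icc.prod (isCompact_closedBall x δ)
  have hc : ContinuousOn (fun p : ℝ × E => p.1 ^ (k + 1) • fderiv ℝ G (p.1 • p.2))
      (Set.Icc (0 : ℝ) 1 ×ˢ Metric.closedBall x δ) :=
    (continuous_fst.pow _).continuousOn.smul
      ((continuousOn_comp_smul hG').mono (Set.prod_mono le_rfl hδr))
  obtain ⟨C, hC⟩ := hK.exists_bound_of_continuousOn hc
  have hIoc : Set.uIoc (0 : ℝ) 1 = Set.Ioc 0 1 := Set.uIoc_of_le zero_le_one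
  refine intervalIntegral.hasFDerivAt_integral_of_dominated_of_fderiv_le
    (s := Metric.closedBall x δ) (bound := fun _ => C)
    (F' := fun y t => t ^ (k + 1) • fderiv ℝ G (t • y)) (Metric.closedBall_mem_nhds x hδ)
    ?_ ?_ ?_ ?_ ?_ ?_
  · filter_upwards [Metric.isOpen_ball.mem_nhds hx] with y hy
    rw [hIoc]
    exact ((hcont k hGc y hy).mono Set.Ioc_subset_Icc_self).aestronglyMeasurable
      measurableSet_Ioc
  · exact (hcont k hGc x hx).intervalIntegrable_of_Icc zero_le_one
  · rw [hIoc]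
    exact ((hcont (k + 1) hG' x hx).mono Set.Ioc_subset_Icc_self).aestronglyMeasurable
      measurableSet_Ioc
  · refine Eventually.of_forall fun t ht y hy => hC (t, y) ⟨?_, hy⟩
    rw [hIoc] at ht
    exact Set.Ioc_subset_Icc_self ht
  · exact intervalIntegrable_const
  · refine Eventually.of_forall fun t ht y hy => ?_
    rw [hIoc] at ht
    have hty := smul_mem_ball_zero (Set.Ioc_subset_Icc_self ht) (hδr hy)
    have h1 : HasFDerivAt G (fderiv ℝ G (t • y)) (t • y) :=
      ((hG.contDiffAt (Metric.isOpen_ball.mem_nhds hty)).differentiableAt (by simp)).hasFDerivAt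
    have h2 : HasFDerivAt (fun y : E => t • y) (t • ContinuousLinearMap.id ℝ E) y :=
      (hasFDerivAt_id y).const_smul t
    have h3 := (h1.comp y h2).const_smul (t ^ k)
    convert! h3 using 1
    ext v
    simp [pow_succ, smul_smul]

/-- Averages of a smooth function over the segment from the centre of a ball are smooth. One
order of differentiability is lost, which spares a separate argument for continuity. -/
theorem contDiffOn_integral_pow_smul_comp_smul [FiniteDimensional ℝ E] (n : ℕ) {V : Type}
    [NormedAddCommGroup V] [NormedSpace ℝ V] [CompleteSpace V] (k : ℕ) {G : E → V} {r : ℝ}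
    (hG : ContDiffOn ℝ (n + 1) G (Metric.ball 0 r)) :
    ContDiffOn ℝ n (fun x => ∫ t in (0 : ℝ)..1, t ^ k • G (t • x)) (Metric.ball 0 r) := by
  induction n generalizing V k with
  | zero =>
    refine contDiffOn_zero.2 fun x hx => ?_
    exact (hasFDerivAt_integral_pow_smul_comp_smul k (by simpa using hG)
      hx).continuousAt.continuousWithinAt
  | succ n ih =>
    have hd : ∀ x ∈ Metric.ball (0 : E) r, _ := fun x hx =>
      hasFDerivAt_integral_pow_smul_comp_smul k (hG.of_le (by simp)) hx
    push_cast
    rw [contDiffOn_succ_iff_fderiv_of_isOpen Metric.isOpen_ball]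
    refine ⟨fun x hx => (hd x hx).differentiableAt.differentiableWithinAt, by simp, ?_⟩
    refine (ih (k + 1) (G := fderiv ℝ G) ?_).congr fun x hx => (hd x hx).fderiv
    exact hG.fderiv_of_isOpen Metric.isOpen_ball (by push_cast; rfl)

end Parametric

/-! ### Square roots of operators near the identity -/

section SquareRoot

variable {F : Type*} [NormedAddCommGroup F] [InnerProductSpace ℝ F] [CompleteSpace F]

/-- The square root is the local inverse of `a ↦ a * a` at `1`. It preserves self-adjointness because
`star (r a)` is another square root of `a` close to `1`. -/
theorem exists_smooth_sqrt_near_one :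
    ∃ r : (F →L[ℝ] F) → (F →L[ℝ] F), r 1 = 1 ∧ ∀ᶠ a in 𝓝 (1 : F →L[ℝ] F),
      ContDiffAt ℝ ∞ r a ∧ r a * r a = a ∧ (IsSelfAdjoint a → IsSelfAdjoint (r a)) := by
  have hsq : ContDiff ℝ ∞ fun a : F →L[ℝ] F => a * a := contDiff_id.mul contDiff_id
  let two : (F →L[ℝ] F) ≃L[ℝ] (F →L[ℝ] F) :=
    ContinuousLinearEquiv.smulLeft (Units.mk0 (2 : ℝ) two_ne_zero)
  have hd : HasFDerivAt (fun a : F →L[ℝ] F => a * a) (two : (F →L[ℝ] F) →L[ℝ] (F →L[ℝ] F)) 1 := by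
    convert! (hasFDerivAt_id (𝕜 := ℝ) (1 : F →L[ℝ] F)).mul'
      (hasFDerivAt_id (𝕜 := ℝ) (1 : F →L[ℝ] F)) using 1
    refine ContinuousLinearMap.ext fun a => ?_
    change (2 : ℝ) • a = 1 * a + a * 1
    rw [two_smul, one_mul, mul_one]
  obtain ⟨e, he1, -, hee, -, hes⟩ := exists_smooth_chart
    (Eventually.of_forall fun a => hsq.contDiffAt) hd univ_mem
  have h1 : e 1 = 1 := by rw [hee, mul_one]
  have hr1 : e.symm 1 = 1 := by
    nth_rewrite 1 [← h1]
    exact e.left_inv he1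
  have ht1 : (1 : F →L[ℝ] F) ∈ e.target := h1 ▸ e.map_source he1
  have hcont : ContinuousAt (fun a => star (e.symm a)) 1 :=
    (e.continuousAt_symm ht1).star
  have hev : ∀ᶠ a in 𝓝 (1 : F →L[ℝ] F), star (e.symm a) ∈ e.source := by
    refine hcont.eventually_mem ?_
    rw [hr1, star_one]
    exact e.open_source.mem_nhds he1
  refine ⟨e.symm, hr1, ?_⟩
  filter_upwards [hev, e.open_target.mem_nhds ht1] with a ha hat
  have hsq' : e.symm a * e.symm a = a := by rw [← hee, e.right_inv hat]
  refine ⟨hes.contDiffAt (e.open_target.mem_nhds hat), hsq', fun hsa => ?_⟩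
  refine e.injOn ha (e.map_target hat) ?_
  rw [hee, hee, hsq', ← star_mul, hsq', hsa.star_eq]

end SquareRoot

/-! ### Second-order Taylor remainder -/

section Taylor

variable {E : Type} [NormedAddCommGroup E] [NormedSpace ℝ E]

theorem clm_integral_sub_integral_smul [CompleteSpace E] (Λ : E →L[ℝ] ℝ) {g : ℝ → E}
    (hg : ContinuousOn g (Set.Icc 0 1)) :
    Λ ((∫ t in (0 : ℝ)..1, t ^ 0 • g t) - ∫ t in (0 : ℝ)..1, t ^ 1 • g t) =
      ∫ t in (0 : ℝ)..1, (1 - t) * Λ (g t) := by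
  have hpow : ∀ k : ℕ, IntervalIntegrable (fun t : ℝ => t ^ k • g t) volume 0 1 := fun k =>
    ((continuous_pow k).continuousOn.smul hg).intervalIntegrable_of_Icc zero_le_one
  rw [← intervalIntegral.integral_sub (hpow 0) (hpow 1),
    ← Λ.intervalIntegral_comp_comm ((hpow 0).sub (hpow 1))]
  refine intervalIntegral.integral_congr fun t _ => ?_
  simp
  ring

/-- Second-order Hadamard lemma: the remainder of the first-order Taylor expansion is a quadratic
form with coefficients depending smoothly on the point. It is
`B x = ∫₀¹ (1 - t) D²f (t x) dt`. -/
theorem exists_smooth_quadratic_remainder [FiniteDimensional ℝ E] {f : E → ℝ} {r : ℝ} (hr : 0 < r)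
    (hf : ContDiffOn ℝ ∞ f (Metric.ball 0 r)) :
    ∃ B : E → E →L[ℝ] E →L[ℝ] ℝ, ContDiffOn ℝ ∞ B (Metric.ball 0 r) ∧
      (∀ x ∈ Metric.ball (0 : E) r, ∀ y z, B x y z = B x z y) ∧
      B 0 = (1 / 2 : ℝ) • fderiv ℝ (fderiv ℝ f) 0 ∧
      ∀ x ∈ Metric.ball (0 : E) r, f x = f 0 + fderiv ℝ f 0 x + B x x x := by
  have ho : IsOpen (Metric.ball (0 : E) r) := Metric.isOpen_ball
  set G := fderiv ℝ (fderiv ℝ f) with hGdef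
  have hf1 : ContDiffOn ℝ ∞ (fderiv ℝ f) (Metric.ball 0 r) := hf.fderiv_of_isOpen ho (by simp)
  have hG : ContDiffOn ℝ ∞ G (Metric.ball 0 r) := hf1.fderiv_of_isOpen ho (by simp)
  have hint : ∀ k : ℕ, ContDiffOn ℝ ∞ (fun x => ∫ t in (0 : ℝ)..1, t ^ k • G (t • x))
      (Metric.ball 0 r) := fun k => contDiffOn_infty.2 fun n =>
    contDiffOn_integral_pow_smul_comp_smul n k (hG.of_le (by exact_mod_cast le_top))
  have hGc : ∀ x ∈ Metric.ball (0 : E) r, ContinuousOn (fun t : ℝ => G (t • x)) (Set.Icc 0 1) :=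
    fun x hx => (continuousOn_comp_smul hG.continuousOn).comp (f := fun t : ℝ => (t, x))
      (by fun_prop) fun t ht => ⟨ht, hx⟩
  have hB : ∀ x ∈ Metric.ball (0 : E) r, ∀ y z,
      ((∫ t in (0 : ℝ)..1, t ^ 0 • G (t • x)) - ∫ t in (0 : ℝ)..1, t ^ 1 • G (t • x)) y z =
        ∫ t in (0 : ℝ)..1, (1 - t) * G (t • x) y z := by
    intro x hx y z
    let Λ : (E →L[ℝ] E →L[ℝ] ℝ) →L[ℝ] ℝ := (ContinuousLinearMap.apply ℝ ℝ z).comp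
      (ContinuousLinearMap.apply ℝ (E →L[ℝ] ℝ) y)
    exact clm_integral_sub_integral_smul (E := E →L[ℝ] E →L[ℝ] ℝ) Λ (hGc x hx)
  refine ⟨fun x => (∫ t in (0 : ℝ)..1, t ^ 0 • G (t • x)) - ∫ t in (0 : ℝ)..1, t ^ 1 • G (t • x),
    (hint 0).sub (hint 1), ?_, ?_, ?_⟩
  · intro x hx y z
    rw [hB x hx, hB x hx]
    refine intervalIntegral.integral_congr fun t ht => ?_
    rw [Set.uIcc_of_le zero_le_one] at ht
    have h2 : ContDiffAt ℝ ∞ f (t • x) := hf.contDiffAt (ho.mem_nhds (smul_mem_ball_zero ht hx))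
    have := (h2.isSymmSndFDerivAt (by
      simpa using (WithTop.coe_le_coe.2 le_top : ((2 : ℕ∞) : WithTop ℕ∞) ≤ ∞))).eq y z
    simp only [hGdef]
    rw [this]
  · ext y z
    rw [hB 0 (Metric.mem_ball_self hr)]
    simp only [smul_zero, intervalIntegral.integral_mul_const, smul_apply,
      smul_eq_mul]
    congr 1
    rw [intervalIntegral.integral_sub (by simp) (by simp)]
    norm_num
  · intro x hx
    rw [hB x hx]
    have hd : ∀ t ∈ Set.uIcc (0 : ℝ) 1,
        HasDerivAt (fun t : ℝ => (1 - t) * fderiv ℝ f (t • x) x + f (t • x))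
          ((1 - t) * G (t • x) x x) t := by
      intro t ht
      rw [Set.uIcc_of_le zero_le_one] at ht
      have hm := ho.mem_nhds (smul_mem_ball_zero ht hx)
      have hline : HasDerivAt (fun t : ℝ => t • x) x t := by
        simpa using (hasDerivAt_id t).smul_const x
      have h0 : HasDerivAt (fun t : ℝ => f (t • x)) (fderiv ℝ f (t • x) x) t :=
        (((hf.contDiffAt hm).differentiableAt (by simp)).hasFDerivAt).comp_hasDerivAt t hline
      have h1 : HasDerivAt (fun t : ℝ => fderiv ℝ f (t • x)) (G (t • x) x) t :=
        (((hf1.contDiffAt hm).differentiableAt (by simp)).hasFDerivAt).comp_hasDerivAt t hline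
      have h2 := h1.clm_apply (hasDerivAt_const t x)
      have h3 := (((hasDerivAt_id t).const_sub 1).mul h2).add h0
      convert! h3 using 1
      simp
    have hi : IntervalIntegrable (fun t : ℝ => (1 - t) * G (t • x) x x) volume 0 1 := by
      refine ContinuousOn.intervalIntegrable_of_Icc zero_le_one ?_
      exact (continuous_const.sub continuous_id).continuousOn.mul
        (((hGc x hx).clm_apply continuousOn_const).clm_apply continuousOn_const)
    rw [intervalIntegral.integral_eq_sub_of_hasDerivAt hd hi]
    simp
    ring

end Taylor

/-! ### The Morse lemma at a nondegenerate minimum -/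

section Morse

variable {F : Type} [NormedAddCommGroup F] [InnerProductSpace ℝ F] [FiniteDimensional ℝ F]

/-- The Morse lemma at a nondegenerate minimum. If `B x` is the smooth quadratic remainder,
represented by the symmetric operator `T x`, then `ψ x = √(T x) x` satisfies
`f x = f 0 + ‖ψ x‖ ^ 2`; the local inverse of `ψ` is the required substitution. -/
theorem morse_lemma_of_posDef {f : F → ℝ} (hf : ∀ᶠ x in 𝓝 0, ContDiffAt ℝ ∞ f x)
    (hf1 : fderiv ℝ f 0 = 0) (hf2 : ∀ y z, fderiv ℝ (fderiv ℝ f) 0 y z = 2 * inner ℝ y z) :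
    ∃ χ : F → F, (∀ᶠ z in 𝓝 0, ContDiffAt ℝ ∞ χ z) ∧ χ 0 = 0 ∧
      HasFDerivAt χ (ContinuousLinearMap.id ℝ F) 0 ∧ ∀ᶠ z in 𝓝 0, f (χ z) = f 0 + ‖z‖ ^ 2 := by
  obtain ⟨r, hr, hball⟩ := Metric.eventually_nhds_iff_ball.1 hf
  obtain ⟨B, hBs, hBsymm, hB0, hBf⟩ := exists_smooth_quadratic_remainder hr
    fun x hx => (hball x hx).contDiffWithinAt
  obtain ⟨sq, hsq1, hsq⟩ := exists_smooth_sqrt_near_one (F := F)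
  set b := stdOrthonormalBasis ℝ F
  -- `T x` represents the bilinear form `B x` with respect to the inner product
  set T : F → F →L[ℝ] F := fun x => ∑ i, (B x (b i)).smulRight (b i) with hT
  have hTin : ∀ x y z, inner ℝ (T x y) z = B x z y := by
    intro x y z
    have hz : z = ∑ i, inner ℝ (b i) z • b i := (b.sum_repr' z).symm
    conv_rhs => rw [hz]
    simp [hT, sum_inner, inner_smul_left, mul_comm]
  have h0 : (0 : F) ∈ Metric.ball (0 : F) r := Metric.mem_ball_self hr
  have hTs : ContDiffOn ℝ ∞ T (Metric.ball 0 r) :=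
    ContDiffOn.sum fun i _ => (hBs.clm_apply contDiffOn_const).smulRight contDiffOn_const
  have hT0 : T 0 = 1 := by
    refine ContinuousLinearMap.ext fun y => ext_inner_right ℝ fun z => ?_
    rw [hTin, hB0]
    simp [hf2, real_inner_comm]
  have hTsa : ∀ x ∈ Metric.ball (0 : F) r, IsSelfAdjoint (T x) := by
    intro x hx
    rw [ContinuousLinearMap.isSelfAdjoint_iff_isSymmetric]
    intro y z
    rw [ContinuousLinearMap.coe_coe, hTin, hBsymm x hx, ← hTin, real_inner_comm]
  have hTc : Tendsto T (𝓝 0) (𝓝 1) := by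
    have := (hTs.continuousOn.continuousAt (Metric.isOpen_ball.mem_nhds h0)).tendsto
    rwa [hT0] at this
  have hev := (hTc.eventually hsq).and (Metric.isOpen_ball.mem_nhds h0)
  set ψ : F → F := fun x => sq (T x) x with hψ
  have hSs : ∀ᶠ x in 𝓝 0, ContDiffAt ℝ ∞ (fun x => sq (T x)) x := by
    filter_upwards [hev] with x hx
    exact hx.1.1.comp x (hTs.contDiffAt (Metric.isOpen_ball.mem_nhds hx.2))
  have hψs : ∀ᶠ x in 𝓝 0, ContDiffAt ℝ ∞ ψ x := by
    filter_upwards [hSs] with x hx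
    exact hx.clm_apply contDiffAt_id
  have hψ0 : ψ 0 = 0 := by simp [hψ]
  have hψd : HasFDerivAt ψ ((ContinuousLinearEquiv.refl ℝ F : F ≃L[ℝ] F) : F →L[ℝ] F) 0 := by
    have h1 := (hSs.self_of_nhds.differentiableAt (by simp)).hasFDerivAt
    have h2 := h1.clm_apply (hasFDerivAt_id (0 : F))
    convert! h2 using 1
    ext v
    simp [hT0, hsq1]
  have hψf : ∀ᶠ x in 𝓝 0, f x = f 0 + ‖ψ x‖ ^ 2 := by
    filter_upwards [hev] with x hx
    obtain ⟨⟨-, hx2, hx3⟩, hxr⟩ := hx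
    rw [hBf x hxr, hf1, ← hTin, ← hx2, ← real_inner_self_eq_norm_sq]
    have := (ContinuousLinearMap.isSelfAdjoint_iff_isSymmetric.1 (hx3 (hTsa x hxr))) (sq (T x) x) x
    simpa [hψ] using this
  obtain ⟨e, he0, hesub, hee, -, hes⟩ := exists_smooth_chart hψs hψd hψf
  have he00 : e 0 = 0 := by rw [hee, hψ0]
  have ht0 : (0 : F) ∈ e.target := he00 ▸ e.map_source he0
  have hs0 : e.symm 0 = 0 := by
    nth_rewrite 1 [← he00]
    exact e.left_inv he0
  refine ⟨e.symm, ?_, hs0, ?_, ?_⟩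
  · filter_upwards [e.open_target.mem_nhds ht0] with z hz
    exact hes.contDiffAt (e.open_target.mem_nhds hz)
  · refine e.hasFDerivAt_symm (f' := ContinuousLinearEquiv.refl ℝ F) ht0 ?_
    rw [hs0]
    exact hψd.congr_of_eventuallyEq (Eventually.of_forall hee)
  · filter_upwards [e.open_target.mem_nhds ht0] with z hz
    rw [hesub (e.map_target hz), ← hee, e.right_inv hz]

end Morse

/-! ### Normal form along an orbit of symmetries -/

section NormalForm

theorem fderiv_fderiv_comp_add_linear {E F : Type*} [NormedAddCommGroup E] [NormedSpace ℝ E]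
    [NormedAddCommGroup F] [NormedSpace ℝ F] {f : E → ℝ} {w : E} (hf : ContDiffAt ℝ 2 f w)
    (L : F →L[ℝ] E) (y z : F) :
    fderiv ℝ (fderiv ℝ fun z => f (w + L z)) 0 y z = fderiv ℝ (fderiv ℝ f) w (L y) (L z) := by
  have hL : ∀ z, HasFDerivAt (fun z => w + L z) L z := fun z => L.hasFDerivAt.const_add w
  have hL0 : Tendsto (fun z => w + L z) (𝓝 0) (𝓝 w) := by
    simpa using (hL 0).continuousAt.tendsto
  have h1 : (fderiv ℝ fun z => f (w + L z)) =ᶠ[𝓝 0]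
      fun z => (ContinuousLinearMap.compL ℝ F E ℝ).flip L (fderiv ℝ f (w + L z)) := by
    filter_upwards [hL0.eventually (hf.eventually (by simp))] with z hz
    exact ((hz.differentiableAt (by simp)).hasFDerivAt.comp z (hL z)).fderiv
  have h2 : HasFDerivAt (fderiv ℝ f) (fderiv ℝ (fderiv ℝ f) w) (w + L 0) := by
    rw [map_zero, add_zero]
    exact ((hf.fderiv_right (m := 1) (by norm_num)).differentiableAt (by simp)).hasFDerivAt
  have h3 := ((ContinuousLinearMap.compL ℝ F E ℝ).flip L).hasFDerivAt.comp 0 (h2.comp 0 (hL 0))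
  rw [(h3.congr_of_eventuallyEq h1).fderiv]
  simp

variable {ι : Type} [Fintype ι] [DecidableEq ι]

/-- Normal form at a minimum that is nondegenerate up to a one-parameter symmetry. The
Hessian is diagonal in the orthonormal basis `v`, positive off `v i₀`, and the orbit of `w` under
the flow `R` preserving `f` crosses the span of the other `v i` transversally. The chart is the
inverse of `u ↦ R (u i₀) (w + L (χ u'))`, where `u'` omits the coordinate `i₀`, the linear map
`L` rescales the eigenvectors and `χ` comes from the Morse lemma on the slice. -/
theorem exists_chart_eq_sum_sq {f : EuclideanSpace ℝ ι → ℝ} {w τ : EuclideanSpace ℝ ι}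
    (hf : ∀ᶠ x in 𝓝 w, ContDiffAt ℝ ∞ f x) (hf1 : fderiv ℝ f w = 0)
    (v : OrthonormalBasis ι ℝ (EuclideanSpace ℝ ι)) (μ : ι → ℝ) (i₀ : ι)
    (hμ : ∀ i ≠ i₀, 0 < μ i)
    (hv : ∀ i j, fderiv ℝ (fderiv ℝ f) w (v i) (v j) = if i = j then μ i else 0)
    (R : ℝ → EuclideanSpace ℝ ι → EuclideanSpace ℝ ι)
    (hR : ContDiff ℝ ∞ fun p : ℝ × EuclideanSpace ℝ ι => R p.1 p.2) (hR0 : ∀ x, R 0 x = x)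
    (hRf : ∀ t x, f (R t x) = f x) (hRτ : HasDerivAt (fun t => R t w) τ 0)
    (hτ : inner ℝ (v i₀) τ ≠ 0) :
    ∃ e : OpenPartialHomeomorph (EuclideanSpace ℝ ι) (EuclideanSpace ℝ ι),
      w ∈ e.source ∧ e w = 0 ∧ ContDiffOn ℝ ∞ e e.source ∧ ContDiffOn ℝ ∞ e.symm e.target ∧
      ∀ x ∈ e.source, f x = f w + ∑ i ∈ Finset.univ.erase i₀, e x i ^ 2 := by
  let κ := {i : ι // i ≠ i₀}
  let c : κ → ℝ := fun i => √(2 / μ i)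
  have hc : ∀ i : κ, 0 < c i := fun i => Real.sqrt_pos.2 (div_pos two_pos (hμ i i.2))
  have hcμ : ∀ i : κ, c i * c i * μ i = 2 := fun i => by
    have := hμ i i.2
    rw [Real.mul_self_sqrt (by positivity)]
    field_simp
  -- scaled so that the Hessian of `f (w + L z)` is twice the standard inner product
  let L : EuclideanSpace ℝ κ →L[ℝ] EuclideanSpace ℝ ι :=
    ∑ i : κ, (c i • EuclideanSpace.proj i).smulRight (v i)
  have hL : ∀ z, L z = ∑ i : κ, (c i * z i) • v i := fun z => by simp [L]
  have hLv : ∀ z (i : κ), inner ℝ (v i) (L z) = c i * z i := by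
    intro z i
    rw [hL, inner_sum]
    simp only [inner_smul_right, v.inner_eq_ite, Subtype.coe_inj]
    simp
  have hLv0 : ∀ z, inner ℝ (v i₀) (L z) = 0 := by
    intro z
    rw [hL, inner_sum]
    refine Finset.sum_eq_zero fun i _ => ?_
    rw [inner_smul_right, v.inner_eq_ite, if_neg i.2.symm, mul_zero]
  let res : EuclideanSpace ℝ ι →L[ℝ] EuclideanSpace ℝ κ :=
    (EuclideanSpace.equiv κ ℝ).symm.toContinuousLinearMap.comp
      (ContinuousLinearMap.pi fun i : κ => EuclideanSpace.proj i.1)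
  have hres : ∀ u (i : κ), res u i = u i := fun u i => rfl
  -- the slice function and its Morse coordinates
  have hg2 : ∀ y z, fderiv ℝ (fderiv ℝ fun z => f (w + L z)) 0 y z = 2 * inner ℝ y z := by
    intro y z
    rw [fderiv_fderiv_comp_add_linear (hf.self_of_nhds.of_le
      (WithTop.coe_le_coe.2 le_top : ((2 : ℕ∞) : WithTop ℕ∞) ≤ ∞))]
    simp only [hL, map_sum, map_smul, sum_apply, smul_apply, hv, smul_eq_mul,
      Subtype.coe_inj]
    simp only [mul_ite, mul_zero, PiLp.inner_apply, Finset.mul_sum]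
    refine Finset.sum_congr rfl fun i _ => ?_
    rw [Finset.sum_eq_single i (fun j _ hj => if_neg hj) (by simp), if_pos rfl]
    simp only [RCLike.inner_apply, conj_trivial]
    linear_combination (y i * z i) * hcμ i
  have hLw : ∀ z, HasFDerivAt (fun z => w + L z) L z := fun z => L.hasFDerivAt.const_add w
  have hLw0 : Tendsto (fun z => w + L z) (𝓝 0) (𝓝 w) := by
    simpa using (hLw 0).continuousAt.tendsto
  have hLs : ContDiff ℝ ∞ fun z => w + L z := contDiff_const.add L.contDiff
  have hgs : ∀ᶠ z in 𝓝 0, ContDiffAt ℝ ∞ (fun z => f (w + L z)) z := by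
    filter_upwards [hLw0.eventually hf] with z hz
    exact hz.comp z hLs.contDiffAt
  have hg1 : fderiv ℝ (fun z => f (w + L z)) 0 = 0 := by
    have h1 : HasFDerivAt f (fderiv ℝ f w) (w + L 0) := by
      rw [map_zero, add_zero]
      exact (hf.self_of_nhds.differentiableAt (by simp)).hasFDerivAt
    have := (h1.comp 0 (hLw 0)).fderiv
    rw [hf1, ContinuousLinearMap.zero_comp] at this
    exact this
  obtain ⟨χ, hχs, hχ0, hχd, hχf⟩ := morse_lemma_of_posDef hgs hg1 hg2
  -- the derivative of the flow at `(0, w)`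
  have hA : HasFDerivAt (fun p : ℝ × EuclideanSpace ℝ ι => R p.1 p.2)
      (fderiv ℝ (fun p : ℝ × EuclideanSpace ℝ ι => R p.1 p.2) (0, w)) (0, w) :=
    (hR.contDiffAt.differentiableAt (by simp)).hasFDerivAt
  set A := fderiv ℝ (fun p : ℝ × EuclideanSpace ℝ ι => R p.1 p.2) (0, w)
  have hA1 : ∀ s, A (s, 0) = s • τ := by
    have h1 : HasDerivAt (fun t : ℝ => (t, w)) ((1 : ℝ), (0 : EuclideanSpace ℝ ι)) 0 :=
      (hasDerivAt_id (0 : ℝ)).prodMk (hasDerivAt_const _ _)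
    have h2' : HasDerivAt (fun t => R t w) (A (1, 0)) 0 :=
      HasFDerivAt.comp_hasDerivAt (l := fun p : ℝ × EuclideanSpace ℝ ι => R p.1 p.2) (l' := A)
        (0 : ℝ) hA h1
    have h2 : A (1, 0) = τ := h2'.unique hRτ
    intro s
    rw [← h2, ← map_smul]
    simp
  have hA2 : ∀ y, A (0, y) = y := by
    have h1 : HasFDerivAt (fun x : EuclideanSpace ℝ ι => ((0 : ℝ), x))
        (ContinuousLinearMap.inr ℝ ℝ (EuclideanSpace ℝ ι)) w := hasFDerivAt_prodMk_right 0 w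
    have h2 := hA.comp w h1
    have h3 : HasFDerivAt (fun x : EuclideanSpace ℝ ι => x)
        (A.comp (ContinuousLinearMap.inr ℝ ℝ (EuclideanSpace ℝ ι))) w :=
      h2.congr_of_eventuallyEq (Eventually.of_forall fun x => (hR0 x).symm)
    intro y
    exact DFunLike.congr_fun (h3.unique (hasFDerivAt_id w)) y
  let Θ : EuclideanSpace ℝ ι → EuclideanSpace ℝ ι := fun u => R (u i₀) (w + L (χ (res u)))
  let M : EuclideanSpace ℝ ι →L[ℝ] EuclideanSpace ℝ ι :=
    (EuclideanSpace.proj i₀).smulRight τ + L.comp res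
  have hM : ∀ u, M u = u i₀ • τ + L (res u) := fun u => rfl
  have hres0 : res 0 = 0 := map_zero res
  have hΘ0 : Θ 0 = w := by simp [Θ, hres0, hχ0, hR0]
  have hΘd : HasFDerivAt Θ M 0 := by
    have h1 : HasFDerivAt (fun u : EuclideanSpace ℝ ι => u i₀)
        (EuclideanSpace.proj i₀ : EuclideanSpace ℝ ι →L[ℝ] ℝ) 0 :=
      (EuclideanSpace.proj i₀ : EuclideanSpace ℝ ι →L[ℝ] ℝ).hasFDerivAt
    have h2 : HasFDerivAt (fun u => w + L (χ (res u)))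
        (L.comp ((ContinuousLinearMap.id ℝ (EuclideanSpace ℝ κ)).comp res)) 0 :=
      (hLw _).comp 0 (HasFDerivAt.comp (0 : EuclideanSpace ℝ ι) (by rw [hres0]; exact hχd)
        res.hasFDerivAt)
    have h3 := HasFDerivAt.comp (g := fun p : ℝ × EuclideanSpace ℝ ι => R p.1 p.2) (g' := A)
      (0 : EuclideanSpace ℝ ι) (by simpa [hres0, hχ0] using hA) (h1.prodMk h2)
    convert! h3 using 1
    refine ContinuousLinearMap.ext fun u => ?_
    have : A (u i₀, L (res u)) = A (u i₀, 0) + A (0, L (res u)) := by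
      rw [← map_add]
      simp
    rw [hA1, hA2] at this
    rw [hM, ← this]
    rfl
  -- pairing with `v i₀` isolates the flow time, since `L` maps into the orthogonal complement
  have hMinj : Function.Injective M := by
    refine (injective_iff_map_eq_zero M).2 fun u hu => ?_
    rw [hM] at hu
    have h0 : u i₀ = 0 := by
      have h1 : inner ℝ (v i₀) (u i₀ • τ + L (res u)) = 0 := by rw [hu, inner_zero_right]
      rw [inner_add_right, hLv0, inner_smul_right, add_zero] at h1
      exact (mul_eq_zero.1 h1).resolve_right hτ
    ext i
    by_cases hi : i = i₀
    · rw [hi, h0]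
      rfl
    · have h1 : inner ℝ (v i) (u i₀ • τ + L (res u)) = 0 := by rw [hu, inner_zero_right]
      rw [h0, zero_smul, zero_add, hLv (res u) ⟨i, hi⟩] at h1
      exact (mul_eq_zero.1 h1).resolve_left (hc ⟨i, hi⟩).ne'
  let M' : EuclideanSpace ℝ ι ≃L[ℝ] EuclideanSpace ℝ ι :=
    (LinearEquiv.ofInjectiveEndo (M : EuclideanSpace ℝ ι →ₗ[ℝ] EuclideanSpace ℝ ι)
      hMinj).toContinuousLinearEquiv
  have hM' : (M' : EuclideanSpace ℝ ι →L[ℝ] EuclideanSpace ℝ ι) = M :=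
    ContinuousLinearMap.ext fun u => rfl
  have hrest : Tendsto res (𝓝 0) (𝓝 0) := by simpa using res.continuous.tendsto 0
  have hΘs : ∀ᶠ u in 𝓝 0, ContDiffAt ℝ ∞ Θ u := by
    filter_upwards [hrest.eventually hχs] with u hu
    have h1 : ContDiffAt ℝ ∞ (fun u : EuclideanSpace ℝ ι => u i₀) u :=
      (EuclideanSpace.proj i₀ : EuclideanSpace ℝ ι →L[ℝ] ℝ).contDiff.contDiffAt
    have h2 : ContDiffAt ℝ ∞ (fun u => w + L (χ (res u))) u :=
      hLs.contDiffAt.comp u (ContDiffAt.comp u hu res.contDiff.contDiffAt)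
    exact hR.contDiffAt.comp u (h1.prodMk h2)
  obtain ⟨e, he0, hesub, hee, hes, hesymm⟩ := exists_smooth_chart hΘs (hM'.symm ▸ hΘd)
    (hrest.eventually hχf)
  have hew : e 0 = w := by rw [hee, hΘ0]
  refine ⟨e.symm, ?_, ?_, hesymm, by simpa using hes, ?_⟩
  · rw [e.symm_source, ← hew]
    exact e.map_source he0
  · rw [← hew, e.left_inv he0]
  · intro x hx
    have hx' : e.symm x ∈ e.source := e.map_target hx
    have h1 : f (w + L (χ (res (e.symm x)))) = f (w + L 0) + ‖res (e.symm x)‖ ^ 2 := hesub hx'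
    have h2 : f x = f (w + L (χ (res (e.symm x)))) := by
      conv_lhs => rw [← e.right_inv hx, hee]
      exact hRf _ _
    rw [h2, h1, map_zero, add_zero, EuclideanSpace.norm_sq_eq]
    congr 1
    simp only [hres, Real.norm_eq_abs, sq_abs]
    exact (Finset.sum_subtype (Finset.univ.erase i₀) (p := fun i => i ≠ i₀) (by simp)
      fun i => e.symm x i ^ 2).symm

end NormalForm

/-! ### Curves and small spheres -/

section Curve

variable {E : Type*} [NormedAddCommGroup E] [InnerProductSpace ℝ E]

/-- A regular curve through `w` meets a small sphere around `w` at most once on each side. -/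
theorem exists_injective_dist_of_hasStrictDerivAt {γ : ℝ → E} {v w : E} (hγ0 : γ 0 = w)
    (hγ : HasStrictDerivAt γ v 0) (hv : v ≠ 0) :
    ∃ δ > 0, ∀ a b : ℝ, |a| < δ → |b| < δ → 0 < a * b → dist (γ a) w = dist (γ b) w → a = b := by
  have hv' : 0 < ‖v‖ := norm_pos_iff.2 hv
  have h1 := hγ.hasStrictFDerivAt.isLittleO.def (c := ‖v‖ / 4) (by positivity)
  obtain ⟨δ, hδ, h2⟩ := Metric.eventually_nhds_iff.1 h1
  -- `γ a - γ b` is close to `(a - b) • v`; equal distances make it orthogonal to the sum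
  -- `(γ a - w) + (γ b - w)`, which is close to `(a + b) • v`
  have hest : ∀ a b : ℝ, |a| < δ → |b| < δ → ‖γ a - γ b - (a - b) • v‖ ≤ ‖v‖ / 4 * |a - b| := by
    intro a b ha hb
    have := h2 (y := (a, b)) (by simpa [Prod.dist_eq, Real.dist_eq] using ⟨ha, hb⟩)
    simpa using this
  refine ⟨δ, hδ, fun a b ha hb hab hd => ?_⟩
  by_contra hne
  have hab' : |a| + |b| = |a + b| := by
    rcases mul_pos_iff.1 hab with ⟨h, h'⟩ | ⟨h, h'⟩
    · rw [abs_of_pos h, abs_of_pos h', abs_of_pos (add_pos h h')]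
    · rw [abs_of_neg h, abs_of_neg h', abs_of_neg (add_neg h h')]
      ring
  have hapos : 0 < |a + b| := by
    rw [← hab']
    have : a ≠ 0 := fun h => by simp [h] at hab
    positivity
  have hspos : 0 < |a - b| := abs_pos.2 (sub_ne_zero.2 hne)
  set r := γ a - γ b - (a - b) • v with hr
  set ra := γ a - w - a • v with hra
  set rb := γ b - w - b • v with hrb
  have h0 : |(0 : ℝ)| < δ := by simpa using hδ
  have hr1 : ‖r‖ ≤ ‖v‖ / 4 * |a - b| := hest a b ha hb
  have hra1 : ‖ra‖ ≤ ‖v‖ / 4 * |a| := by simpa [hra, hγ0] using hest a 0 ha h0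
  have hrb1 : ‖rb‖ ≤ ‖v‖ / 4 * |b| := by simpa [hrb, hγ0] using hest b 0 hb h0
  have hs1 : ‖ra + rb‖ ≤ ‖v‖ / 4 * |a + b| := by
    rw [← hab']
    linarith [norm_add_le ra rb]
  have hzero : inner ℝ ((a - b) • v + r) ((a + b) • v + (ra + rb)) = 0 := by
    have e1 : (a - b) • v + r = (γ a - w) - (γ b - w) := by rw [hr]; abel
    have e2 : (a + b) • v + (ra + rb) = (γ a - w) + (γ b - w) := by
      rw [hra, hrb, add_smul]; abel
    rw [e1, e2, real_inner_comm, real_inner_add_sub_eq_zero_iff, ← dist_eq_norm, ← dist_eq_norm, hd]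
  generalize ra + rb = rs at hs1 hzero
  rw [inner_add_left, inner_add_right, inner_add_right, inner_smul_left, inner_smul_right,
    inner_smul_left, inner_smul_right, real_inner_self_eq_norm_sq] at hzero
  simp only [conj_trivial] at hzero
  have c1 := abs_real_inner_le_norm v rs
  have c2 := abs_real_inner_le_norm r v
  have c3 := abs_real_inner_le_norm r rs
  set n := ‖v‖
  set p := |a - b|
  set q := |a + b|
  have d1 : |(a - b) * inner ℝ v rs| ≤ p * (n * (n / 4 * q)) := by
    rw [abs_mul]
    gcongr
    exact c1.trans (by gcongr)
  have d2 : |(a + b) * inner ℝ r v| ≤ q * (n / 4 * p * n) := by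
    rw [abs_mul]
    gcongr
    exact c2.trans (by gcongr)
  have d3 : |inner ℝ r rs| ≤ n / 4 * p * (n / 4 * q) := c3.trans (by gcongr)
  have d4 : |(a - b) * ((a + b) * n ^ 2)| = p * (q * n ^ 2) := by
    rw [abs_mul, abs_mul, abs_of_nonneg (sq_nonneg n)]
  have d5 : (a - b) * ((a + b) * n ^ 2) =
      -((a - b) * inner ℝ v rs) - (a + b) * inner ℝ r v - inner ℝ r rs := by
    linear_combination hzero
  have d6 : |(a - b) * ((a + b) * n ^ 2)| ≤
      p * (n * (n / 4 * q)) + q * (n / 4 * p * n) + n / 4 * p * (n / 4 * q) := by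
    rw [d5]
    refine (abs_sub _ _).trans (add_le_add ((abs_sub _ _).trans (add_le_add ?_ d2)) d3)
    rwa [abs_neg]
  rw [d4] at d6
  have : 0 < p * q * n ^ 2 := by positivity
  nlinarith

end Curve

/-! ### Scaling all coordinates but one -/

section Scaling

theorem volume_coord_mem_eq_zero {ι : Type*} [Fintype ι] (i₀ : ι) {N : Set ℝ} (hN : N.Countable) :
    volume {u : EuclideanSpace ℝ ι | u i₀ ∈ N} = 0 := by
  have h : {u : EuclideanSpace ℝ ι | u i₀ ∈ N} =
      ⋃ c ∈ N, (fun u : EuclideanSpace ℝ ι => u.ofLp) ⁻¹' {g : ι → ℝ | g i₀ = c} := by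
    ext u
    simp
  rw [h, measure_biUnion_null_iff hN]
  intro c _
  exact (PiLp.volume_preserving_ofLp ι).quasiMeasurePreserving.preimage_null
    (by rw [volume_pi]; exact Measure.pi_hyperplane (fun _ : ι => (volume : Measure ℝ)) i₀ c)

variable {ι : Type*} [Fintype ι] [DecidableEq ι]

/-- The linear map fixing the coordinate `i₀` and multiplying all others by `s`. -/
noncomputable def scaleOff (i₀ : ι) (s : ℝ) : EuclideanSpace ℝ ι →L[ℝ] EuclideanSpace ℝ ι :=
  Matrix.toEuclideanCLM (𝕜 := ℝ) (Matrix.diagonal fun i => if i = i₀ then 1 else s)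

theorem scaleOff_apply (i₀ : ι) (s : ℝ) (u : EuclideanSpace ℝ ι) (i : ι) :
    scaleOff i₀ s u i = (if i = i₀ then 1 else s) * u i := by
  simp [scaleOff, Matrix.ofLp_toEuclideanCLM, Matrix.mulVec_diagonal]

theorem det_scaleOff (i₀ : ι) (s : ℝ) : (scaleOff i₀ s).det = s ^ (Fintype.card ι - 1) := by
  have h : ((scaleOff i₀ s : EuclideanSpace ℝ ι →L[ℝ] EuclideanSpace ℝ ι) :
      EuclideanSpace ℝ ι →ₗ[ℝ] EuclideanSpace ℝ ι) =
      Matrix.toLin (EuclideanSpace.basisFun ι ℝ).toBasis (EuclideanSpace.basisFun ι ℝ).toBasis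
        (Matrix.diagonal fun i => if i = i₀ then 1 else s) := rfl
  rw [ContinuousLinearMap.det, h, LinearMap.det_toLin, Matrix.det_diagonal, Finset.prod_ite]
  simp [Finset.filter_ne', Finset.card_univ]

theorem scaleOff_scaleOff (i₀ : ι) (s t : ℝ) (u : EuclideanSpace ℝ ι) :
    scaleOff i₀ s (scaleOff i₀ t u) = scaleOff i₀ (s * t) u := by
  ext i
  simp only [scaleOff_apply]
  split_ifs <;> ring

theorem scaleOff_one (i₀ : ι) (u : EuclideanSpace ℝ ι) : scaleOff i₀ 1 u = u := by
  ext i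
  simp [scaleOff_apply]

theorem scaleOff_zero (i₀ : ι) (u : EuclideanSpace ℝ ι) :
    scaleOff i₀ 0 u = u i₀ • EuclideanSpace.single i₀ 1 := by
  ext i
  by_cases h : i = i₀ <;> simp [scaleOff_apply, h]

theorem continuous_scaleOff (i₀ : ι) (u : EuclideanSpace ℝ ι) :
    Continuous fun s => scaleOff i₀ s u := by
  have h : (fun s => scaleOff i₀ s u) =
      fun s => WithLp.toLp 2 fun i => (if i = i₀ then 1 else s) * u i := by
    funext s
    ext i
    rw [scaleOff_apply]
  rw [h]
  refine (PiLp.continuous_toLp 2 _).comp (continuous_pi fun i => ?_)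
  split_ifs <;> fun_prop

end Scaling

/-! ### Volume of sublevel sets -/

section Volume

variable {ι : Type} [Fintype ι] [DecidableEq ι]

/-- Every small sphere around `w` meets the curve `s ↦ e.symm (s • e_{i₀})` at countably many
parameters only, since the curve meets it at most once on each side of `w`. -/
theorem eventually_countable_sphere (e : OpenPartialHomeomorph (EuclideanSpace ℝ ι)
      (EuclideanSpace ℝ ι)) {w : EuclideanSpace ℝ ι} (hw : w ∈ e.source) (hw0 : e w = 0)
    (hs : ContDiffOn ℝ ∞ e e.source) (hs' : ContDiffOn ℝ ∞ e.symm e.target) (i₀ : ι) :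
    ∀ᶠ ρ in 𝓝[>] (0 : ℝ), {s : ℝ | s • EuclideanSpace.single i₀ (1 : ℝ) ∈
      e '' Metric.closedBall w ρ ∧
      dist (e.symm (s • EuclideanSpace.single i₀ (1 : ℝ))) w = ρ}.Countable := by
  set b : EuclideanSpace ℝ ι := EuclideanSpace.single i₀ 1 with hb
  have hbn : ‖b‖ = 1 := by simp [hb]
  have h0t : (0 : EuclideanSpace ℝ ι) ∈ e.target := hw0 ▸ e.map_source hw
  have hsymm0 : e.symm 0 = w := by
    rw [← hw0, e.left_inv hw]
  have hd : HasStrictFDerivAt e.symm (fderiv ℝ e.symm 0) 0 :=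
    (hs'.contDiffAt (e.open_target.mem_nhds h0t)).hasStrictFDerivAt (by simp)
  have hline : HasStrictDerivAt (fun s : ℝ => s • b) b 0 := by
    simpa using (hasStrictDerivAt_id (0 : ℝ)).smul_const b
  have hγ : HasStrictDerivAt (fun s : ℝ => e.symm (s • b)) (fderiv ℝ e.symm 0 b) 0 :=
    HasStrictFDerivAt.comp_hasStrictDerivAt (l := e.symm) (0 : ℝ) (by simpa using hd) hline
  have hv : fderiv ℝ e.symm 0 b ≠ 0 := by
    intro h
    have h1 : HasFDerivAt e (fderiv ℝ e w) (e.symm 0) := by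
      rw [hsymm0]
      exact ((hs.contDiffAt (e.open_source.mem_nhds hw)).differentiableAt (by simp)).hasFDerivAt
    have h2 := h1.comp 0 hd.hasFDerivAt
    have h3 : HasFDerivAt (fun y : EuclideanSpace ℝ ι => y)
        ((fderiv ℝ e w).comp (fderiv ℝ e.symm 0)) 0 := by
      refine h2.congr_of_eventuallyEq ?_
      filter_upwards [e.open_target.mem_nhds h0t] with y hy
      exact (e.right_inv hy).symm
    have h4 := DFunLike.congr_fun (h3.unique (hasFDerivAt_id _)) b
    rw [ContinuousLinearMap.comp_apply, h, map_zero] at h4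
    have : b = 0 := h4.symm
    rw [this, norm_zero] at hbn
    exact zero_ne_one hbn
  obtain ⟨δ, hδ, hinj⟩ := exists_injective_dist_of_hasStrictDerivAt (w := w)
    (by simpa using hsymm0) hγ hv
  have hnhds : e ⁻¹' Metric.ball 0 δ ∈ 𝓝 w := by
    refine (e.continuousAt hw).preimage_mem_nhds ?_
    rw [hw0]
    exact Metric.ball_mem_nhds 0 hδ
  obtain ⟨ρ₀, hρ₀, hsub⟩ := Metric.nhds_basis_closedBall.mem_iff.1 hnhds
  filter_upwards [Ioo_mem_nhdsGT hρ₀] with ρ hρ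
  set N := {s : ℝ | s • b ∈ e '' Metric.closedBall w ρ ∧ dist (e.symm (s • b)) w = ρ} with hN
  have hNδ : ∀ s ∈ N, |s| < δ := by
    rintro s ⟨⟨x, hx, hxs⟩, -⟩
    have h1 : e x ∈ Metric.ball 0 δ := hsub (Metric.closedBall_subset_closedBall hρ.2.le hx)
    rw [hxs, mem_ball_zero_iff, norm_smul, hbn, mul_one] at h1
    exact h1
  have hpos : (N ∩ Set.Ioi 0).Subsingleton := fun s hs t ht =>
    hinj s t (hNδ s hs.1) (hNδ t ht.1) (mul_pos hs.2 ht.2) (hs.1.2.trans ht.1.2.symm)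
  have hneg : (N ∩ Set.Iio 0).Subsingleton := fun s hs t ht =>
    hinj s t (hNδ s hs.1) (hNδ t ht.1) (mul_pos_of_neg_of_neg hs.2 ht.2) (hs.1.2.trans ht.1.2.symm)
  refine ((hpos.countable.union hneg.countable).union (Set.countable_singleton 0)).mono
    fun s hs => ?_
  rcases lt_trichotomy s 0 with h | h | h
  · exact Or.inl (Or.inr ⟨hs, h⟩)
  · exact Or.inr h
  · exact Or.inl (Or.inl ⟨hs, h⟩)

/-- If `f - f w` is the sum of the squares of all coordinates but one in a smooth chart centred
at `w`, then the local learning coefficient is half the number of squares. Rescaling these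
coordinates by `√ε` turns the sublevel volume into `ε ^ ((n - 1) / 2)` times an integral that
converges by dominated convergence to the integral of the Jacobian along the minimal curve. -/
theorem hasLocalLearningCoefficient_of_chart {f : EuclideanSpace ℝ ι → ℝ}
    (e : OpenPartialHomeomorph (EuclideanSpace ℝ ι) (EuclideanSpace ℝ ι))
    {w : EuclideanSpace ℝ ι} (hw : w ∈ e.source) (hw0 : e w = 0)
    (hs : ContDiffOn ℝ ∞ e e.source) (hs' : ContDiffOn ℝ ∞ e.symm e.target) (i₀ : ι)
    (hf : ∀ x ∈ e.source, f x = f w + ∑ i ∈ Finset.univ.erase i₀, e x i ^ 2) :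
    HasLocalLearningCoefficient f w (((Fintype.card ι - 1 : ℕ) : ℝ) / 2) := by
  -- no logarithm: the exponent of `-log ε` is `0`
  refine ⟨?_, 0, ?_⟩
  · filter_upwards [e.open_source.mem_nhds hw] with x hx
    rw [hf x hx]
    exact le_add_of_nonneg_right (Finset.sum_nonneg fun i _ => sq_nonneg _)
  have h0t : (0 : EuclideanSpace ℝ ι) ∈ e.target := hw0 ▸ e.map_source hw
  have hsymm0 : e.symm 0 = w := by rw [← hw0, e.left_inv hw]
  obtain ⟨ρ₀, hρ₀, hsub⟩ := Metric.nhds_basis_closedBall.mem_iff.1 (e.open_source.mem_nhds hw)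
  filter_upwards [Ioo_mem_nhdsGT hρ₀, eventually_countable_sphere e hw hw0 hs hs' i₀] with ρ hρ hN
  have hBs : Metric.closedBall w ρ ⊆ e.source :=
    (Metric.closedBall_subset_closedBall hρ.2.le).trans hsub
  set K := e '' Metric.closedBall w ρ with hK
  have hKc : IsCompact K := (isCompact_closedBall w ρ).image_of_continuousOn
    (e.continuousOn.mono hBs)
  have hKt : K ⊆ e.target := by
    rintro _ ⟨x, hx, rfl⟩
    exact e.map_source (hBs hx)
  have hKmem : ∀ y ∈ e.target, dist (e.symm y) w ≤ ρ → y ∈ K := fun y hy h =>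
    ⟨e.symm y, h, e.right_inv hy⟩
  have hKle : ∀ y ∈ K, dist (e.symm y) w ≤ ρ := by
    rintro _ ⟨x, hx, rfl⟩
    rwa [e.left_inv (hBs hx)]
  set D := scaleOff i₀ with hD
  set J : EuclideanSpace ℝ ι → ℝ := fun y => |(fderiv ℝ e.symm y).det| with hJ
  have hψd : ∀ y ∈ e.target, HasFDerivAt e.symm (fderiv ℝ e.symm y) y := fun y hy =>
    ((hs'.contDiffAt (e.open_target.mem_nhds hy)).differentiableAt (by simp)).hasFDerivAt
  have hJc : ContinuousOn J e.target :=
    (ContinuousLinearMap.continuous_det.comp_continuousOn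
      (hs'.continuousOn_fderiv_of_isOpen e.open_target (by simp))).abs
  -- the domain and the integrand after rescaling by `s = √ε`
  set T : ℝ → Set (EuclideanSpace ℝ ι) := fun s =>
    {u | D s u ∈ K ∧ ∑ i ∈ Finset.univ.erase i₀, u i ^ 2 < 1} with hT
  set F : ℝ → EuclideanSpace ℝ ι → ℝ := fun s => (T s).indicator fun u => J (D s u) with hF
  have hsumc : Continuous fun u : EuclideanSpace ℝ ι => ∑ i ∈ Finset.univ.erase i₀, u i ^ 2 := by
    fun_prop
  have hTm : ∀ s, MeasurableSet (T s) := fun s =>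
    (hKc.isClosed.preimage (D s).continuous).measurableSet.inter
      (isOpen_lt hsumc continuous_const).measurableSet
  have hFm : ∀ s, AEStronglyMeasurable (F s) volume := fun s => by
    rw [hF, aestronglyMeasurable_indicator_iff (hTm s)]
    exact (hJc.comp (D s).continuous.continuousOn fun u hu => hKt hu.1).aestronglyMeasurable (hTm s)
  -- the coordinate `i₀` is bounded on `K`, the others by the condition on the sum of squares
  obtain ⟨M, hM⟩ := hKc.isBounded.exists_norm_le
  obtain ⟨C₀, hC₀⟩ := hKc.exists_bound_of_continuousOn (hJc.mono hKt)
  set bound : EuclideanSpace ℝ ι → ℝ :=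
    (Metric.closedBall 0 (|M| + 1)).indicator fun _ => |C₀| with hbound
  have hbi : Integrable bound volume :=
    (integrable_indicator_iff measurableSet_closedBall).2
      (integrableOn_const (measure_closedBall_lt_top).ne)
  have hFb : ∀ s u, ‖F s u‖ ≤ bound u := by
    intro s u
    by_cases hu : u ∈ T s
    · have hu1 : |u i₀| ≤ |M| := by
        have h1 : D s u i₀ = u i₀ := by simp [hD, scaleOff_apply]
        rw [← h1, ← Real.norm_eq_abs]
        exact ((PiLp.norm_apply_le _ _).trans (hM _ hu.1)).trans (le_abs_self M)
      have hu2 : u ∈ Metric.closedBall (0 : EuclideanSpace ℝ ι) (|M| + 1) := by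
        rw [mem_closedBall_zero_iff]
        refine abs_le_of_sq_le_sq' ?_ (by positivity) |>.2
        rw [EuclideanSpace.norm_sq_eq, ← Finset.add_sum_erase _ _ (Finset.mem_univ i₀)]
        simp only [Real.norm_eq_abs, sq_abs]
        have h3 : u i₀ ^ 2 ≤ |M| ^ 2 := by
          rw [← sq_abs]
          gcongr
        nlinarith [hu.2, abs_nonneg M]
      rw [hF, hbound]
      simp only
      rw [Set.indicator_of_mem hu, Set.indicator_of_mem hu2]
      exact (hC₀ _ hu.1).trans (le_abs_self _)
    · rw [hF]
      simp only
      rw [Set.indicator_of_notMem hu, norm_zero]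
      exact Set.indicator_nonneg (fun _ _ => abs_nonneg _) _
  -- the integrand converges unless the limit point lies on the boundary sphere
  have hlim : ∀ᵐ u, Tendsto (fun s => F s u) (𝓝[>] 0) (𝓝 (F 0 u)) := by
    have hnull := volume_coord_mem_eq_zero i₀ hN
    filter_upwards [compl_mem_ae_iff.2 hnull] with u hu
    have hu' : ¬ (D 0 u ∈ K ∧ dist (e.symm (D 0 u)) w = ρ) := by
      rw [hD, scaleOff_zero]
      exact hu
    have hDt : Tendsto (fun s => D s u) (𝓝[>] 0) (𝓝 (D 0 u)) :=
      ((continuous_scaleOff i₀ u).tendsto 0).mono_left nhdsWithin_le_nhds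
    by_cases h1 : ∑ i ∈ Finset.univ.erase i₀, u i ^ 2 < 1
    · by_cases h2 : D 0 u ∈ K
      · have h3 : dist (e.symm (D 0 u)) w < ρ :=
          lt_of_le_of_ne (hKle _ h2) fun h => hu' ⟨h2, h⟩
        have h4 : ∀ᶠ y in 𝓝 (D 0 u), y ∈ K := by
          have hc : ContinuousAt (fun y => dist (e.symm y) w) (D 0 u) :=
            (e.continuousAt_symm (hKt h2)).dist continuousAt_const
          filter_upwards [e.open_target.mem_nhds (hKt h2), hc.eventually_lt_const h3] with y hy hy'
          exact hKmem y hy hy'.le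
        have h5 : Tendsto (fun s => J (D s u)) (𝓝[>] 0) (𝓝 (F 0 u)) := by
          have h6 : F 0 u = J (D 0 u) := Set.indicator_of_mem (s := T 0) ⟨h2, h1⟩ _
          rw [h6]
          exact (hJc.continuousAt (e.open_target.mem_nhds (hKt h2))).tendsto.comp hDt
        refine h5.congr' ?_
        filter_upwards [hDt.eventually h4] with s hs
        have h7 : F s u = J (D s u) := Set.indicator_of_mem (s := T s) ⟨hs, h1⟩ _
        exact h7.symm
      · have h6 : F 0 u = 0 := Set.indicator_of_notMem (s := T 0) (fun h => h2 h.1) _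
        rw [h6]
        refine tendsto_const_nhds.congr' ?_
        filter_upwards [hDt.eventually (hKc.isClosed.isOpen_compl.mem_nhds h2)] with s hs
        have h7 : F s u = 0 := Set.indicator_of_notMem (s := T s) (fun h => hs h.1) _
        exact h7.symm
    · have h6 : ∀ s, F s u = 0 := fun s =>
        Set.indicator_of_notMem (s := T s) (fun h => h1 h.2) _
      simp only [h6]
      exact tendsto_const_nhds
  have hDCT : Tendsto (fun s => ∫ u, F s u) (𝓝[>] 0) (𝓝 (∫ u, F 0 u)) :=
    tendsto_integral_filter_of_dominated_convergence bound (Eventually.of_forall hFm)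
      (Eventually.of_forall fun s => Eventually.of_forall (hFb s)) hbi hlim
  have hpos : 0 < ∫ u, F 0 u := by
    have hJpos : ∀ y ∈ e.target, 0 < J y := by
      intro y hy
      refine abs_pos.2 fun h => ?_
      have hx := e.map_target hy
      have h1 : HasFDerivAt e (fderiv ℝ e (e.symm y)) (e.symm y) :=
        ((hs.contDiffAt (e.open_source.mem_nhds hx)).differentiableAt (by simp)).hasFDerivAt
      have h3 : HasFDerivAt (fun y : EuclideanSpace ℝ ι => y)
          ((fderiv ℝ e (e.symm y)).comp (fderiv ℝ e.symm y)) y := by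
        refine (h1.comp y (hψd y hy)).congr_of_eventuallyEq ?_
        filter_upwards [e.open_target.mem_nhds hy] with z hz
        exact (e.right_inv hz).symm
      have h4 := congrArg ContinuousLinearMap.det (h3.unique (hasFDerivAt_id _))
      have h5 : ((fderiv ℝ e (e.symm y)).comp (fderiv ℝ e.symm y)).det =
          (fderiv ℝ e (e.symm y)).det * (fderiv ℝ e.symm y).det := LinearMap.det_comp _ _
      have h6 : (ContinuousLinearMap.id ℝ (EuclideanSpace ℝ ι)).det = 1 := LinearMap.det_id
      rw [h5, h6, h, mul_zero] at h4
      exact zero_ne_one h4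
    have hnonneg : 0 ≤ F 0 := fun u => Set.indicator_nonneg (fun _ _ => abs_nonneg _) u
    rw [integral_pos_iff_support_of_nonneg hnonneg
      (hbi.mono' (hFm 0) (Eventually.of_forall (hFb 0)))]
    refine MeasureTheory.Measure.measure_pos_of_mem_nhds (x := 0) volume ?_
    have hK0 : K ∈ 𝓝 (0 : EuclideanSpace ℝ ι) := by
      have hc : ContinuousAt (fun y => dist (e.symm y) w) 0 :=
        (e.continuousAt_symm h0t).dist continuousAt_const
      filter_upwards [e.open_target.mem_nhds h0t,
        hc.eventually_lt_const (u := ρ) (by simpa [hsymm0] using hρ.1)] with y hy hy'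
      exact hKmem y hy hy'.le
    have h1 : Tendsto (D 0) (𝓝 0) (𝓝 0) := by simpa using (D 0).continuous.tendsto 0
    have h2 : ∀ᶠ u : EuclideanSpace ℝ ι in 𝓝 0, ∑ i ∈ Finset.univ.erase i₀, u i ^ 2 < 1 :=
      hsumc.continuousAt.eventually_lt_const (by simp)
    filter_upwards [h1.eventually hK0, h2] with u hu1 hu2
    have h6 : F 0 u = J (D 0 u) := Set.indicator_of_mem (s := T 0) ⟨hu1, hu2⟩ _
    rw [Function.mem_support, h6]
    exact (hJpos _ (hKt hu1)).ne'
  -- change of variables `x = e.symm (D √ε u)`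
  have hvol : ∀ ε > 0, sublevelVolume f w ρ ε =
      √ε ^ (Fintype.card ι - 1) * ∫ u, F √ε u := by
    intro ε hε
    have hsε : 0 < √ε := Real.sqrt_pos.2 hε
    have hsq : √ε ^ 2 = ε := Real.sq_sqrt hε.le
    have hsum : ∀ u, ∑ i ∈ Finset.univ.erase i₀, D √ε u i ^ 2 =
        ε * ∑ i ∈ Finset.univ.erase i₀, u i ^ 2 := by
      intro u
      rw [Finset.mul_sum]
      refine Finset.sum_congr rfl fun i hi => ?_
      rw [hD, scaleOff_apply, if_neg (Finset.ne_of_mem_erase hi), mul_pow, hsq]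
    have hset : {x ∈ Metric.closedBall w ρ | f x - f w < ε} = (e.symm ∘ D √ε) '' T √ε := by
      ext x
      constructor
      · rintro ⟨hx, hxf⟩
        have h1 : D √ε (D (√ε)⁻¹ (e x)) = e x := by
          rw [hD, scaleOff_scaleOff, mul_inv_cancel₀ hsε.ne', scaleOff_one]
        refine ⟨D (√ε)⁻¹ (e x), ⟨?_, ?_⟩, ?_⟩
        · rw [h1]
          exact ⟨x, hx, rfl⟩
        · have h2 := hsum (D (√ε)⁻¹ (e x))
          rw [h1] at h2
          rw [hf x (hBs hx), add_sub_cancel_left, h2] at hxf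
          exact (mul_lt_iff_lt_one_right hε).1 hxf
        · rw [Function.comp_apply, h1, e.left_inv (hBs hx)]
      · rintro ⟨u, ⟨hu1, hu2⟩, rfl⟩
        refine ⟨hKle _ hu1, ?_⟩
        rw [Function.comp_apply, hf _ (e.map_target (hKt hu1)), e.right_inv (hKt hu1),
          add_sub_cancel_left, hsum]
        exact (mul_lt_iff_lt_one_right hε).2 hu2
    have hinj : Set.InjOn (e.symm ∘ D √ε) (T √ε) := by
      intro u hu u' hu' h
      have h1 : D √ε u = D √ε u' := e.symm.injOn (hKt hu.1) (hKt hu'.1) h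
      have h2 := congrArg (D (√ε)⁻¹) h1
      rwa [hD, scaleOff_scaleOff, scaleOff_scaleOff, inv_mul_cancel₀ hsε.ne', scaleOff_one,
        scaleOff_one] at h2
    have hder : ∀ u ∈ T √ε, HasFDerivWithinAt (e.symm ∘ D √ε)
        ((fderiv ℝ e.symm (D √ε u)).comp (D √ε)) (T √ε) u := fun u hu =>
      ((hψd _ (hKt hu.1)).comp u (D √ε).hasFDerivAt).hasFDerivWithinAt
    have hint := integral_image_eq_integral_abs_det_fderiv_smul volume (hTm √ε) hder hinj
      fun _ => (1 : ℝ)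
    rw [← hset] at hint
    have hl : sublevelVolume f w ρ ε =
        ∫ x in {x ∈ Metric.closedBall w ρ | f x - f w < ε}, (1 : ℝ) := by
      simp [sublevelVolume]
    rw [hl, hint, ← integral_const_mul, ← integral_indicator (hTm _)]
    congr 1
    funext u
    by_cases hu : u ∈ T √ε
    · have h6 : F √ε u = J (D √ε u) := Set.indicator_of_mem hu _
      have h7 : ((fderiv ℝ e.symm (D √ε u)).comp (D √ε)).det =
          (fderiv ℝ e.symm (D √ε u)).det * (D √ε).det := LinearMap.det_comp _ _
      rw [Set.indicator_of_mem hu, h6, h7, det_scaleOff, abs_mul,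
        abs_of_nonneg (pow_nonneg hsε.le _)]
      simp only [hJ, smul_eq_mul]
      ring
    · have h6 : F √ε u = 0 := Set.indicator_of_notMem hu _
      rw [Set.indicator_of_notMem hu, h6, mul_zero]
  refine ⟨∫ u, F 0 u, hpos, ?_⟩
  have hsqrt : Tendsto (fun ε : ℝ => √ε) (𝓝[>] 0) (𝓝[>] 0) := by
    refine tendsto_nhdsWithin_iff.2 ⟨?_, ?_⟩
    · simpa using (Real.continuous_sqrt.tendsto 0).mono_left nhdsWithin_le_nhds
    · filter_upwards [self_mem_nhdsWithin] with ε hε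
      exact Real.sqrt_pos.2 hε
  refine (hDCT.comp hsqrt).congr' ?_
  filter_upwards [self_mem_nhdsWithin] with ε hε
  have hε : 0 < ε := hε
  have hpow : √ε ^ (Fintype.card ι - 1) = ε ^ (((Fintype.card ι - 1 : ℕ) : ℝ) / 2) := by
    rw [Real.sqrt_eq_rpow, ← Real.rpow_natCast, ← Real.rpow_mul hε.le]
    congr 1
    ring
  rw [hvol ε hε, hpow, pow_zero, mul_one, Function.comp_apply,
    mul_div_cancel_left₀ _ (Real.rpow_pos_of_pos hε _).ne']

end Volume

/-! ### The equations for the length and the bias -/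

section PentagonEquations

theorem cos_two_pi_div_five_eq : cos (2 * π / 5) = (√5 - 1) / 4 := by
  have h : 2 * π / 5 = 2 * (π / 5) := by ring
  have h5 : √5 ^ 2 = 5 := Real.sq_sqrt (by norm_num)
  rw [h, cos_two_mul, cos_pi_div_five]
  linear_combination h5 / 8

theorem cos_two_pi_div_five_quadratic : 4 * cos (2 * π / 5) ^ 2 + 2 * cos (2 * π / 5) = 1 := by
  have h5 : √5 ^ 2 = 5 := Real.sq_sqrt (by norm_num)
  rw [cos_two_pi_div_five_eq]
  linear_combination h5 / 4

theorem cos_two_pi_div_five_bounds :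
    0.309016994374 < cos (2 * π / 5) ∧ cos (2 * π / 5) < 0.309016994375 := by
  rw [cos_two_pi_div_five_eq]
  have h1 : (2.236067977498 : ℝ) < √5 := Real.lt_sqrt_of_sq_lt (by norm_num)
  have h2 : √5 < (2.2360679774998 : ℝ) := (Real.sqrt_lt' (by norm_num)).2 (by norm_num)
  constructor <;> linarith

/-- The coefficient of `x²` in the bias equation, after the substitution `y = -t x²` and division
by `x⁴`. -/
def biasCoeff (κ t : ℝ) : ℝ := (1 + 2 * κ) + (5 + 8 * κ) * t ^ 2 - 6 * t

/-- The coefficient of `x²` in the length equation, after the substitution `y = -t x²` and division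
by `x⁶`. -/
def lengthCoeff (κ t : ℝ) : ℝ := (3 - 2 * κ) - 3 * (1 + 2 * κ) * t + (5 + 8 * κ) * t ^ 3

/-- The quartic in the ratio `t = -y / x²` obtained by eliminating `x²`. -/
def ratioPoly (κ t : ℝ) : ℝ :=
  (1 - 6 * κ) + (10 - 12 * κ) * t - (3 + 26 * κ) * t ^ 2 + (7 - 8 * κ) * t ^ 3
    - (5 + 8 * κ) * t ^ 4

theorem ratioPoly_eq (κ t : ℝ) : ratioPoly κ t =
    (1 + t) * lengthCoeff κ t - 2 * (1 + t + t ^ 2) * biasCoeff κ t := by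
  unfold ratioPoly lengthCoeff biasCoeff
  ring

/-- The pentagon equations after the substitution `y = -t x²`, where `1 / cos (2π/5)` is eliminated
with the quadratic equation of `cos (2π/5)`. -/
theorem isPentagonSolution_iff {x t : ℝ} (hx : 0 < x) :
    IsPentagonSolution x (-t * x ^ 2) ↔ 0 ≤ t ∧ t ≤ cos (2 * π / 5) ∧
      x ^ 2 * biasCoeff (cos (2 * π / 5)) t = 1 - t ^ 2 ∧
      x ^ 2 * lengthCoeff (cos (2 * π / 5)) t = 2 * (1 - t ^ 3) := by
  have hq := cos_two_pi_div_five_quadratic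
  have hb := cos_two_pi_div_five_bounds.1
  set κ := cos (2 * π / 5) with hκ
  have hinv : 2 / κ = 4 + 8 * κ := by
    rw [div_eq_iff (by linarith)]
    linear_combination -2 * hq
  have hx2 : 0 < x ^ 2 := by positivity
  have e1 : x ^ 6 * (1 + 2 * κ) + x ^ 2 * (-t * x ^ 2) ^ 2 * (1 + 2 / κ)
      + 2 * x ^ 4 * (-t * x ^ 2) * 3 + (-t * x ^ 2) ^ 2 - x ^ 4 =
      x ^ 4 * (x ^ 2 * biasCoeff κ t - (1 - t ^ 2)) := by
    rw [hinv, biasCoeff]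
    ring
  have e2 : 2 * x ^ 8 * (1 + 2 * κ ^ 2) + 3 * x ^ 6 * (-t * x ^ 2) * (1 + 2 * κ)
      - x ^ 2 * (-t * x ^ 2) ^ 3 * (1 + 2 / κ) - 2 * x ^ 6 - 2 * (-t * x ^ 2) ^ 3 =
      x ^ 6 * (x ^ 2 * lengthCoeff κ t - 2 * (1 - t ^ 3)) := by
    rw [hinv, lengthCoeff]
    linear_combination x ^ 8 * hq
  constructor
  · rintro ⟨-, h2, h3, h4, h5⟩
    rw [← hκ] at h3 h4 h5
    rw [e1] at h4
    rw [e2] at h5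
    refine ⟨by nlinarith, by nlinarith, ?_, ?_⟩
    · exact sub_eq_zero.1 ((mul_eq_zero.1 h4).resolve_left (by positivity))
    · exact sub_eq_zero.1 ((mul_eq_zero.1 h5).resolve_left (by positivity))
  · rintro ⟨h1, h2, h3, h4⟩
    refine ⟨hx, by nlinarith, ?_, ?_, ?_⟩
    · rw [← hκ]
      nlinarith
    · rw [← hκ, e1, h3, sub_self, mul_zero]
    · rw [← hκ, e2, h4, sub_self, mul_zero]

/-- The interval is chosen just wide enough for a sign change of the quartic to be decided by the
bounds on `cos (2π/5)`. -/
theorem exists_ratioPoly_root : ∃ t ∈ Set.Icc (0.20606005 : ℝ) 0.20606006,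
    ratioPoly (cos (2 * π / 5)) t = 0 := by
  obtain ⟨h1, h2⟩ := cos_two_pi_div_five_bounds
  set κ := cos (2 * π / 5)
  have hc : ContinuousOn (ratioPoly κ) (Set.Icc (0.20606005 : ℝ) 0.20606006) := by
    unfold ratioPoly
    fun_prop
  refine intermediate_value_Icc (by norm_num) hc ⟨?_, ?_⟩
  · unfold ratioPoly
    linarith
  · unfold ratioPoly
    linarith

/-- The quartic has at most one root in `[0, cos (2π/5)]`: the difference quotient between the
root near `0.206` and any other point of the interval is positive. -/
theorem ratioPoly_root_unique {s t : ℝ} (hs : s ∈ Set.Icc (0.20606005 : ℝ) 0.20606006)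
    (ht0 : 0 ≤ t) (ht : t ≤ cos (2 * π / 5)) (hs0 : ratioPoly (cos (2 * π / 5)) s = 0)
    (htr : ratioPoly (cos (2 * π / 5)) t = 0) : t = s := by
  obtain ⟨h1, h2⟩ := cos_two_pi_div_five_bounds
  obtain ⟨hs1, hs2⟩ := hs
  set κ := cos (2 * π / 5)
  -- `0.516` exceeds the sum of the upper bounds of `cos (2π/5)` and `s`
  have hts : t + s ≤ 0.516 := by linarith
  have hmul : (t - s) * ((10 - 12 * κ) - (3 + 26 * κ) * (t + s)
      + (7 - 8 * κ) * (t ^ 2 + t * s + s ^ 2) - (5 + 8 * κ) * ((t + s) * (t ^ 2 + s ^ 2))) = 0 := by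
    unfold ratioPoly at hs0 htr
    linear_combination htr - hs0
  refine sub_eq_zero.1 ((mul_eq_zero.1 hmul).resolve_right (ne_of_gt ?_))
  have b1 : (3 + 26 * κ) * (t + s) ≤ (3 + 26 * κ) * 0.516 := by gcongr
  have b2 : (t + s) * (t ^ 2 + s ^ 2) ≤ 0.516 * (t ^ 2 + s ^ 2) := by gcongr
  have b3 : (5 + 8 * κ) * ((t + s) * (t ^ 2 + s ^ 2)) ≤ (5 + 8 * κ) * (0.516 * (t ^ 2 + s ^ 2)) := by
    gcongr
  have b4 : 0 ≤ t * s := mul_nonneg ht0 (by linarith)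
  have b5 : 0 ≤ (7 - 8 * κ) * (t * s) := mul_nonneg (by linarith) b4
  have b6 : 0 ≤ ((7 - 8 * κ) - 0.516 * (5 + 8 * κ)) * (t ^ 2 + s ^ 2) :=
    mul_nonneg (by linarith) (by positivity)
  linarith

/-- A solution of the pentagon equations in terms of the ratio `t = -y / x²`. -/
theorem IsPentagonSolution.ratio {x y : ℝ} (h : IsPentagonSolution x y) :
    ∃ t ∈ Set.Icc (0.20606005 : ℝ) 0.20606006, y = -t * x ^ 2 ∧
      ratioPoly (cos (2 * π / 5)) t = 0 ∧
      x ^ 2 * biasCoeff (cos (2 * π / 5)) t = 1 - t ^ 2 ∧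
      x ^ 2 * lengthCoeff (cos (2 * π / 5)) t = 2 * (1 - t ^ 3) := by
  have hx := h.pos
  obtain ⟨t, rfl⟩ : ∃ t, y = -t * x ^ 2 := ⟨-y / x ^ 2, by field_simp⟩
  obtain ⟨h0, hκ, hA, hB⟩ := (isPentagonSolution_iff hx).1 h
  obtain ⟨s, hs, hs0⟩ := exists_ratioPoly_root
  have h1 := cos_two_pi_div_five_bounds.2
  have hroot : ratioPoly (cos (2 * π / 5)) t = 0 := by
    have h2 : x ^ 2 * (1 - t) * ratioPoly (cos (2 * π / 5)) t = 0 := by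
      rw [ratioPoly_eq]
      linear_combination (1 - t ^ 2) * hB - 2 * (1 - t ^ 3) * hA
    refine (mul_eq_zero.1 h2).resolve_left (mul_ne_zero (by positivity) ?_)
    linarith
  have hts := ratioPoly_root_unique hs h0 hκ hs0 hroot
  exact ⟨t, hts ▸ hs, rfl, hroot, hA, hB⟩

theorem biasCoeff_bounds {t : ℝ} (ht : t ∈ Set.Icc (0.20606005 : ℝ) 0.20606006) :
    0.6989460 < biasCoeff (cos (2 * π / 5)) t ∧ biasCoeff (cos (2 * π / 5)) t < 0.6989463 := by
  obtain ⟨h1, h2⟩ := cos_two_pi_div_five_bounds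
  obtain ⟨hs1, hs2⟩ := ht
  have ht1 : (0.20606005 : ℝ) ^ 2 ≤ t ^ 2 := by gcongr
  have ht2 : t ^ 2 ≤ (0.20606006 : ℝ) ^ 2 := by gcongr
  unfold biasCoeff
  set κ := cos (2 * π / 5)
  have c1 : (5 + 8 * κ) * (0.20606005 : ℝ) ^ 2 ≤ (5 + 8 * κ) * t ^ 2 := by gcongr
  have c2 : (5 + 8 * κ) * t ^ 2 ≤ (5 + 8 * κ) * (0.20606006 : ℝ) ^ 2 := by gcongr
  constructor <;> linarith

theorem sq_length_bounds {x t : ℝ} (ht : t ∈ Set.Icc (0.20606005 : ℝ) 0.20606006)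
    (hA : x ^ 2 * biasCoeff (cos (2 * π / 5)) t = 1 - t ^ 2) :
    1.369975 < x ^ 2 ∧ x ^ 2 < 1.369977 := by
  obtain ⟨h1, h2⟩ := biasCoeff_bounds ht
  obtain ⟨hs1, hs2⟩ := ht
  have ht1 : (0.20606005 : ℝ) ^ 2 ≤ t ^ 2 := by gcongr
  have ht2 : t ^ 2 ≤ (0.20606006 : ℝ) ^ 2 := by gcongr
  constructor <;> nlinarith

theorem IsPentagonSolution.bounds {x y : ℝ} (h : IsPentagonSolution x y) :
    |x - 1.17046| < 0.000005 ∧ |y - (-0.28230)| < 0.000005 := by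
  obtain ⟨t, ht, rfl, -, hA, -⟩ := h.ratio
  obtain ⟨h1, h2⟩ := sq_length_bounds ht hA
  have hx := h.pos
  constructor
  · rw [abs_lt]
    constructor <;> nlinarith
  · obtain ⟨hs1, hs2⟩ := ht
    rw [abs_lt]
    constructor <;> nlinarith

theorem existsUnique_isPentagonSolution : ∃! p : ℝ × ℝ, IsPentagonSolution p.1 p.2 := by
  obtain ⟨t, ht, ht0⟩ := exists_ratioPoly_root
  have hA := (biasCoeff_bounds ht).1
  have hApos : 0 < biasCoeff (cos (2 * π / 5)) t := by linarith
  have hκ := cos_two_pi_div_five_bounds.1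
  have ht1 : t ^ 2 < 1 := by nlinarith [ht.1, ht.2]
  set x := √((1 - t ^ 2) / biasCoeff (cos (2 * π / 5)) t) with hxdef
  have hquot : 0 < (1 - t ^ 2) / biasCoeff (cos (2 * π / 5)) t := div_pos (by linarith) hApos
  have hx : 0 < x := Real.sqrt_pos.2 hquot
  have hx2 : x ^ 2 * biasCoeff (cos (2 * π / 5)) t = 1 - t ^ 2 := by
    rw [hxdef, Real.sq_sqrt hquot.le, div_mul_cancel₀ _ hApos.ne']
  have hB : x ^ 2 * lengthCoeff (cos (2 * π / 5)) t = 2 * (1 - t ^ 3) := by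
    rw [ratioPoly_eq] at ht0
    have h1t : (1 + t) ≠ 0 := by linarith [ht.1]
    refine mul_left_cancel₀ h1t ?_
    linear_combination x ^ 2 * ht0 + 2 * (1 + t + t ^ 2) * hx2
  refine ⟨(x, -t * x ^ 2), (isPentagonSolution_iff hx).2
    ⟨by linarith [ht.1], by linarith [ht.2], hx2, hB⟩, ?_⟩
  rintro ⟨x', y'⟩ h
  have hx' := h.pos
  obtain ⟨t', ht', hy, ht0', hA', -⟩ := h.ratio
  obtain rfl : t' = t := ratioPoly_root_unique ht (by linarith [ht'.1]) (by linarith [ht'.2]) ht0 ht0'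
  simp only at hx' hA' hy
  have hsq : x' ^ 2 = x ^ 2 := mul_right_cancel₀ hApos.ne' (hA'.trans hx2.symm)
  have hxx : x' = x := (pow_left_inj₀ hx'.le hx.le two_ne_zero).1 hsq
  rw [hy, hxx]

end PentagonEquations

/-! ### The potential near a pentagon -/

section LocalFormula

theorem colDot_comm {r c : ℕ} (w : Param r c) (i j : Fin c) : colDot w i j = colDot w j i := by
  simp only [colDot, mul_comm]

theorem contDiff_weight {r c : ℕ} (a : Fin r) (i : Fin c) :
    ContDiff ℝ ∞ fun w : Param r c => weight w a i :=
  (EuclideanSpace.proj (Sum.inl (a, i)) : Param r c →L[ℝ] ℝ).contDiff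

theorem contDiff_bias {r c : ℕ} (i : Fin c) : ContDiff ℝ ∞ fun w : Param r c => bias w i :=
  (EuclideanSpace.proj (Sum.inr i) : Param r c →L[ℝ] ℝ).contDiff

theorem contDiff_colDot {r c : ℕ} (i j : Fin c) :
    ContDiff ℝ ∞ fun w : Param r c => colDot w i j :=
  ContDiff.sum fun a _ => (contDiff_weight a i).mul (contDiff_weight a j)

/-- The conditions under which exactly the terms of `localPotential` are active: the first five
biases are negative, only neighbouring columns interact, and the sixth bias is positive. -/
structure InPentagonChamber (w : Param 2 6) : Prop where
  bias_neg : ∀ k : Fin 5, bias w k.castSucc < 0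
  edge_pos : ∀ k : Fin 5, 0 < colDot w k.castSucc (k + 1).castSucc
  edge_left : ∀ k : Fin 5, 0 < colDot w k.castSucc (k + 1).castSucc + bias w k.castSucc
  edge_right : ∀ k : Fin 5, 0 < colDot w k.castSucc (k + 1).castSucc + bias w (k + 1).castSucc
  diag_neg : ∀ k : Fin 5, colDot w k.castSucc (k + 2).castSucc < 0
  self_pos : ∀ k : Fin 5, 0 < colDot w k.castSucc k.castSucc
  self_bias : ∀ k : Fin 5, 0 < colDot w k.castSucc k.castSucc + bias w k.castSucc
  last_left : ∀ k : Fin 5, colDot w k.castSucc (Fin.last 5) + bias w k.castSucc < 0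
  last_pos : 0 < bias w (Fin.last 5)
  last_right : ∀ k : Fin 5, 0 < colDot w (Fin.last 5) k.castSucc + bias w (Fin.last 5)

/-- The contribution of an ordered pair of interacting columns with dot product `q`. -/
noncomputable def edgeTerm (q b : ℝ) : ℝ := 1 / q * (q + b) ^ 3

/-- The diagonal contribution of a column with squared length `q` and negative bias `b`. -/
noncomputable def vertexTerm (q b : ℝ) : ℝ :=
  b ^ 3 / q ^ 2 + b ^ 3 / q + ((1 - q) ^ 2 - 3 * (1 - q) * b + 3 * b ^ 2)

/-- The smooth function that coincides with the potential in the pentagon chamber. -/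
noncomputable def localPotential (w : Param 2 6) : ℝ :=
  (∑ k : Fin 5,
      (edgeTerm (colDot w k.castSucc (k + 1).castSucc) (bias w k.castSucc)
        + edgeTerm (colDot w k.castSucc (k + 1).castSucc) (bias w (k + 1).castSucc)
        + vertexTerm (colDot w k.castSucc k.castSucc) (bias w k.castSucc)
        + (colDot w (Fin.last 5) k.castSucc ^ 2
          + 3 * colDot w (Fin.last 5) k.castSucc * bias w (Fin.last 5)
          + 3 * bias w (Fin.last 5) ^ 2)))
    + selfTerm w (Fin.last 5)

theorem sum_fin_five_shift (a : Fin 5) (f : Fin 5 → ℝ) : ∑ k, f (k + a) = ∑ k, f k :=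
  Equiv.sum_comp (Equiv.addRight a) f

/-- The column `k` interacts with its neighbours `k + 1` and `k + 4 = k - 1`. The edge to the latter
is written as the edge from `k + 4` to `k + 4 + 1`, so that the sum over `k` can be shifted. -/
theorem InPentagonChamber.potentialNeg_eq {w : Param 2 6} (h : InPentagonChamber w) (k : Fin 5) :
    potentialNeg w k.castSucc =
      edgeTerm (colDot w k.castSucc (k + 1).castSucc) (bias w k.castSucc)
        + edgeTerm (colDot w (k + 4).castSucc (k + 4 + 1).castSucc) (bias w (k + 4 + 1).castSucc)
        + vertexTerm (colDot w k.castSucc k.castSucc) (bias w k.castSucc) := by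
  classical
  have hk : ∀ k : Fin 5, k + 4 + 1 = k := by decide
  have hneg := h.bias_neg k
  have h1 : InPij w k.castSucc (k + 1).castSucc :=
    ⟨h.edge_pos k, by linarith [h.edge_left k], hneg.le⟩
  have h4 : InPij w k.castSucc (k + 4).castSucc := by
    have e1 := h.edge_pos (k + 4)
    have e2 := h.edge_right (k + 4)
    rw [hk, colDot_comm] at e1 e2
    exact ⟨e1, by linarith, hneg.le⟩
  have h2 : ¬ InPij w k.castSucc (k + 2).castSucc := fun hp => (h.diag_neg k).not_gt hp.1
  have h3 : ¬ InPij w k.castSucc (k + 3).castSucc := fun hp => by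
    have e1 := h.diag_neg (k + 3)
    have hk' : ∀ k : Fin 5, k + 3 + 2 = k := by decide
    rw [hk', colDot_comm] at e1
    exact e1.not_gt hp.1
  -- the dot product with the sixth column is smaller than `-b_k`
  have h5 : ¬ InPij w k.castSucc (Fin.last 5) := fun hp => by
    linarith [h.last_left k, hp.2.1]
  have hs : InPi w k.castSucc := ⟨h.self_pos k, by linarith [h.self_bias k], hneg.le⟩
  have hne1 : ∀ k : Fin 5, k + 1 ≠ k := by decide
  have hne4 : ∀ k : Fin 5, k + 4 ≠ k := by decide
  have hne14 : ∀ k : Fin 5, k + 1 ≠ k + 4 := by decide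
  have hcases : ∀ k j : Fin 5, j ≠ k → j ≠ k + 1 → j ≠ k + 4 → j = k + 2 ∨ j = k + 3 := by decide
  rw [potentialNeg, if_pos hs, Finset.sum_eq_add (k + 1).castSucc (k + 4).castSucc,
    if_pos h1, if_pos h4, hk, colDot_comm w (k + 4).castSucc]
  · rfl
  · exact fun he => hne14 k (Fin.castSucc_injective _ he)
  · intro j hj hjne
    refine if_neg ?_
    induction j using Fin.lastCases with
    | last => exact h5
    | cast j =>
      rcases hcases k j (fun he => Finset.ne_of_mem_erase hj (congrArg _ he))
        (fun he => hjne.1 (congrArg _ he)) (fun he => hjne.2 (congrArg _ he)) with rfl | rfl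
      · exact h2
      · exact h3
  · exact fun hm => absurd (Finset.mem_erase.2
      ⟨fun he => hne1 k (Fin.castSucc_injective _ he), Finset.mem_univ _⟩) hm
  · exact fun hm => absurd (Finset.mem_erase.2
      ⟨fun he => hne4 k (Fin.castSucc_injective _ he), Finset.mem_univ _⟩) hm

theorem InPentagonChamber.potentialPos_eq {w : Param 2 6} (h : InPentagonChamber w) :
    potentialPos w (Fin.last 5) =
      (∑ k : Fin 5, (colDot w (Fin.last 5) k.castSucc ^ 2
          + 3 * colDot w (Fin.last 5) k.castSucc * bias w (Fin.last 5)
          + 3 * bias w (Fin.last 5) ^ 2)) + selfTerm w (Fin.last 5) := by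
  classical
  have hQ : ∀ k : Fin 5, ¬ InQij w (Fin.last 5) k.castSucc := fun k hq => by
    linarith [h.last_right k, hq.1]
  rw [potentialPos, Finset.sum_erase_eq_sub (Finset.mem_univ _), Fin.sum_univ_castSucc,
    add_sub_cancel_right]
  congr 1
  exact Finset.sum_congr rfl fun k _ => if_neg (hQ k)

theorem InPentagonChamber.potential_eq {w : Param 2 6} (h : InPentagonChamber w) :
    potential w = localPotential w := by
  rw [potential, Fin.sum_univ_castSucc, if_neg (not_le.2 h.last_pos), h.potentialPos_eq,
    Finset.sum_congr rfl fun k _ => (if_pos (h.bias_neg k).le).trans (h.potentialNeg_eq k),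
    localPotential]
  have hshift := sum_fin_five_shift 4 fun k : Fin 5 =>
    edgeTerm (colDot w k.castSucc (k + 1).castSucc) (bias w (k + 1).castSucc)
  simp only [Finset.sum_add_distrib] at hshift ⊢
  linear_combination hshift

theorem InPentagonChamber.eventually {w : Param 2 6} (h : InPentagonChamber w) :
    ∀ᶠ v in 𝓝 w, InPentagonChamber v := by
  have hb : ∀ i, ContinuousAt (fun v : Param 2 6 => bias v i) w := fun i =>
    (contDiff_bias i).continuous.continuousAt
  have hd : ∀ i j, ContinuousAt (fun v : Param 2 6 => colDot v i j) w := fun i j =>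
    (contDiff_colDot i j).continuous.continuousAt
  filter_upwards [eventually_all.2 fun k => (hb _).eventually_lt_const (h.bias_neg k),
    eventually_all.2 fun k => (hd _ _).eventually_const_lt (h.edge_pos k),
    eventually_all.2 fun k => ((hd _ _).add (hb _)).eventually_const_lt (h.edge_left k),
    eventually_all.2 fun k => ((hd _ _).add (hb _)).eventually_const_lt (h.edge_right k),
    eventually_all.2 fun k => (hd _ _).eventually_lt_const (h.diag_neg k),
    eventually_all.2 fun k => (hd _ _).eventually_const_lt (h.self_pos k),
    eventually_all.2 fun k => ((hd _ _).add (hb _)).eventually_const_lt (h.self_bias k),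
    eventually_all.2 fun k => ((hd _ _).add (hb _)).eventually_lt_const (h.last_left k),
    (hb _).eventually_const_lt h.last_pos,
    eventually_all.2 fun k => ((hd _ _).add (hb _)).eventually_const_lt (h.last_right k)]
    with v h1 h2 h3 h4 h5 h6 h7 h8 h9 h10
  exact ⟨h1, h2, h3, h4, h5, h6, h7, h8, h9, h10⟩

theorem contDiffAt_edgeTerm {E : Type*} [NormedAddCommGroup E] [NormedSpace ℝ E] {q b : E → ℝ}
    {x : E} (hq : ContDiffAt ℝ ∞ q x) (hb : ContDiffAt ℝ ∞ b x) (h0 : q x ≠ 0) :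
    ContDiffAt ℝ ∞ (fun x => edgeTerm (q x) (b x)) x :=
  (contDiffAt_const.div hq h0).mul ((hq.add hb).pow 3)

theorem contDiffAt_vertexTerm {E : Type*} [NormedAddCommGroup E] [NormedSpace ℝ E] {q b : E → ℝ}
    {x : E} (hq : ContDiffAt ℝ ∞ q x) (hb : ContDiffAt ℝ ∞ b x) (h0 : q x ≠ 0) :
    ContDiffAt ℝ ∞ (fun x => vertexTerm (q x) (b x)) x :=
  (((hb.pow 3).div (hq.pow 2) (pow_ne_zero 2 h0)).add ((hb.pow 3).div hq h0)).add
    ((((contDiffAt_const.sub hq).pow 2).sub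
      ((contDiffAt_const.mul (contDiffAt_const.sub hq)).mul hb)).add
      (contDiffAt_const.mul (hb.pow 2)))

theorem InPentagonChamber.contDiffAt_localPotential {w : Param 2 6} (h : InPentagonChamber w) :
    ContDiffAt ℝ ∞ localPotential w := by
  have hb : ∀ i, ContDiffAt ℝ ∞ (fun v : Param 2 6 => bias v i) w := fun i =>
    (contDiff_bias i).contDiffAt
  have hd : ∀ i j, ContDiffAt ℝ ∞ (fun v : Param 2 6 => colDot v i j) w := fun i j =>
    (contDiff_colDot i j).contDiffAt
  refine ContDiffAt.add (ContDiffAt.sum fun k _ => ?_) ?_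
  · refine (((contDiffAt_edgeTerm (hd _ _) (hb _) (h.edge_pos k).ne').add
      (contDiffAt_edgeTerm (hd _ _) (hb _) (h.edge_pos k).ne')).add
      (contDiffAt_vertexTerm (hd _ _) (hb _) (h.self_pos k).ne')).add ?_
    exact (((hd _ _).pow 2).add ((contDiffAt_const.mul (hd _ _)).mul (hb _))).add
      (contDiffAt_const.mul ((hb _).pow 2))
  · exact ((((contDiffAt_const.sub (hd _ _)).pow 2).sub
      ((contDiffAt_const.mul (contDiffAt_const.sub (hd _ _))).mul (hb _))).add
      (contDiffAt_const.mul ((hb _).pow 2)))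

theorem InPentagonChamber.potential_eventuallyEq {w : Param 2 6} (h : InPentagonChamber w) :
    potential =ᶠ[𝓝 w] localPotential :=
  h.eventually.mono fun _ hv => hv.potential_eq

theorem InPentagonChamber.eventually_contDiffAt {w : Param 2 6} (h : InPentagonChamber w) :
    ∀ᶠ v in 𝓝 w, ContDiffAt ℝ ∞ (potential (r := 2) (c := 6)) v :=
  h.eventually.mono fun _ hv =>
    hv.contDiffAt_localPotential.congr_of_eventuallyEq hv.potential_eventuallyEq

end LocalFormula

/-! ### Second-order jets along lines -/

section Jets

/-- `h s = a + b s + c s² + o(s²)` at `s = 0`, in the strong sense that `h` is differentiable near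
`0` and its derivative is differentiable at `0`. -/
def HasTwoJet (h : ℝ → ℝ) (a b c : ℝ) : Prop :=
  ∃ h' : ℝ → ℝ, (∀ᶠ s in 𝓝 0, HasDerivAt h (h' s) s) ∧ HasDerivAt h' (2 * c) 0 ∧
    h 0 = a ∧ h' 0 = b

theorem HasTwoJet.of_eq {h : ℝ → ℝ} {a b c a' b' c' : ℝ} (H : HasTwoJet h a b c)
    (ha : a = a') (hb : b = b') (hc : c = c') : HasTwoJet h a' b' c' := by
  subst ha hb hc
  exact H

theorem HasTwoJet.congr {h g : ℝ → ℝ} {a b c : ℝ} (H : HasTwoJet h a b c)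
    (hg : ∀ s, g s = h s) : HasTwoJet g a b c := by
  rwa [funext hg]

theorem hasTwoJet_quadratic (a b c : ℝ) :
    HasTwoJet (fun s => a + b * s + c * s ^ 2) a b c := by
  refine ⟨fun s => b + 2 * c * s, Eventually.of_forall fun s => ?_, ?_, by simp, by simp⟩
  · convert! (((hasDerivAt_id s).const_mul b).const_add a).add
      ((hasDerivAt_pow 2 s).const_mul c) using 1
    simp
    ring
  · convert! ((hasDerivAt_id (0 : ℝ)).const_mul (2 * c)).const_add b using 1
    simp

theorem hasTwoJet_const (a : ℝ) : HasTwoJet (fun _ => a) a 0 0 :=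
  ⟨fun _ => 0, Eventually.of_forall fun s => hasDerivAt_const s a,
    by simpa using hasDerivAt_const (0 : ℝ) (0 : ℝ), rfl, rfl⟩

theorem HasTwoJet.add {f g : ℝ → ℝ} {a b c a' b' c' : ℝ} (hf : HasTwoJet f a b c)
    (hg : HasTwoJet g a' b' c') :
    HasTwoJet (fun s => f s + g s) (a + a') (b + b') (c + c') := by
  obtain ⟨f', hf1, hf2, rfl, rfl⟩ := hf
  obtain ⟨g', hg1, hg2, rfl, rfl⟩ := hg
  refine ⟨fun s => f' s + g' s, ?_, ?_, rfl, rfl⟩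
  · filter_upwards [hf1, hg1] with s h1 h2
    exact h1.add h2
  · rw [mul_add]
    exact hf2.add hg2

theorem HasTwoJet.mul {f g : ℝ → ℝ} {a b c a' b' c' : ℝ} (hf : HasTwoJet f a b c)
    (hg : HasTwoJet g a' b' c') :
    HasTwoJet (fun s => f s * g s) (a * a') (b * a' + a * b') (c * a' + b * b' + a * c') := by
  obtain ⟨f', hf1, hf2, rfl, rfl⟩ := hf
  obtain ⟨g', hg1, hg2, rfl, rfl⟩ := hg
  refine ⟨fun s => f' s * g s + f s * g' s, ?_, ?_, rfl, rfl⟩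
  · filter_upwards [hf1, hg1] with s h1 h2
    exact h1.mul h2
  · convert! (hf2.mul hg1.self_of_nhds).add (hf1.self_of_nhds.mul hg2) using 1
    ring

theorem HasTwoJet.inv {f : ℝ → ℝ} {a b c : ℝ} (hf : HasTwoJet f a b c) (ha : a ≠ 0) :
    HasTwoJet (fun s => (f s)⁻¹) a⁻¹ (-b / a ^ 2) (b ^ 2 / a ^ 3 - c / a ^ 2) := by
  obtain ⟨f', hf1, hf2, rfl, rfl⟩ := hf
  have hc : ContinuousAt f 0 := hf1.self_of_nhds.continuousAt
  refine ⟨fun s => -f' s / f s ^ 2, ?_, ?_, rfl, rfl⟩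
  · filter_upwards [hf1, hc.eventually_ne ha] with s h1 h2
    exact h1.inv h2
  · convert! hf2.neg.div (hf1.self_of_nhds.pow 2) (pow_ne_zero 2 ha) using 1
    simp
    field_simp
    ring

theorem HasTwoJet.const_mul {f : ℝ → ℝ} {a b c : ℝ} (k : ℝ) (hf : HasTwoJet f a b c) :
    HasTwoJet (fun s => k * f s) (k * a) (k * b) (k * c) :=
  ((hasTwoJet_const k).mul hf).of_eq rfl (by ring) (by ring)

theorem HasTwoJet.sum {ι : Type*} (s : Finset ι) {f : ι → ℝ → ℝ} {a b c : ι → ℝ}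
    (hf : ∀ i ∈ s, HasTwoJet (f i) (a i) (b i) (c i)) :
    HasTwoJet (fun x => ∑ i ∈ s, f i x) (∑ i ∈ s, a i) (∑ i ∈ s, b i) (∑ i ∈ s, c i) := by
  classical
  induction s using Finset.induction_on with
  | empty => simpa using hasTwoJet_const 0
  | insert i s hi ih =>
    simp only [Finset.sum_insert hi]
    exact (hf i (Finset.mem_insert_self i s)).add
      (ih fun j hj => hf j (Finset.mem_insert_of_mem hj))

/-- The first two derivatives of a function can be read off its jets along lines. -/
theorem fderiv_of_hasTwoJet {E : Type*} [NormedAddCommGroup E] [NormedSpace ℝ E] {F : E → ℝ}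
    {w v : E} {a b c : ℝ} (hF : ContDiffAt ℝ 2 F w)
    (h : HasTwoJet (fun s => F (w + s • v)) a b c) :
    fderiv ℝ F w v = b ∧ fderiv ℝ (fderiv ℝ F) w v v = 2 * c := by
  obtain ⟨h', h1, h2, -, rfl⟩ := h
  have hline : ∀ s : ℝ, HasDerivAt (fun s : ℝ => w + s • v) v s := fun s => by
    simpa using ((hasDerivAt_id s).smul_const v).const_add w
  have hl0 : Tendsto (fun s : ℝ => w + s • v) (𝓝 0) (𝓝 w) := by
    simpa using (hline 0).continuousAt.tendsto
  have h3 : ∀ᶠ s in 𝓝 0, fderiv ℝ F (w + s • v) v = h' s := by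
    filter_upwards [h1, hl0.eventually (hF.eventually (by simp))] with s hs hs'
    exact (HasFDerivAt.comp_hasDerivAt (l := F) s (hs'.differentiableAt (by simp)).hasFDerivAt
      (hline s)).unique hs
  have h4 : HasFDerivAt (fderiv ℝ F) (fderiv ℝ (fderiv ℝ F) w) (w + (0 : ℝ) • v) := by
    rw [zero_smul, add_zero]
    exact ((hF.fderiv_right (m := 1) (by norm_num)).differentiableAt (by simp)).hasFDerivAt
  have h5 : HasDerivAt (fun s : ℝ => fderiv ℝ F (w + s • v)) (fderiv ℝ (fderiv ℝ F) w v) 0 :=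
    HasFDerivAt.comp_hasDerivAt (l := fderiv ℝ F) (0 : ℝ) h4 (hline 0)
  have h5 := h5.clm_apply (hasDerivAt_const (0 : ℝ) v)
  refine ⟨by simpa using h3.self_of_nhds, ?_⟩
  have h6 := h5.congr_of_eventuallyEq (f₁ := h') (h3.mono fun s hs => hs.symm)
  simpa using h6.unique h2

/-- Expansion of an edge term when the dot product is `X (κ + d₁ s + d₂ s²)` and the bias is
`X (-t + β s)`. -/
theorem hasTwoJet_edgeTerm {X κ t d₁ d₂ β : ℝ} (hX : X ≠ 0) (hκ : κ ≠ 0) :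
    HasTwoJet (fun s => edgeTerm (X * (κ + d₁ * s + d₂ * s ^ 2)) (X * (-t + β * s)))
      (X ^ 2 * ((κ - t) ^ 3 / κ))
      (X ^ 2 * ((2 * κ - 3 * t + t ^ 3 / κ ^ 2) * d₁ + (3 * κ - 6 * t + 3 * t ^ 2 / κ) * β))
      (X ^ 2 * ((2 * κ - 3 * t + t ^ 3 / κ ^ 2) * d₂ + (1 - t ^ 3 / κ ^ 3) * d₁ ^ 2
        + (3 - 3 * t ^ 2 / κ ^ 2) * (d₁ * β) + (3 - 3 * t / κ) * β ^ 2)) := by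
  have hq := (hasTwoJet_quadratic κ d₁ d₂).const_mul X
  have hb : HasTwoJet (fun s => X * (-t + β * s)) (X * -t) (X * β) 0 := by
    simpa using (hasTwoJet_quadratic (-t) β 0).const_mul X
  have hqb := hq.add hb
  have h := (hq.inv (mul_ne_zero hX hκ)).mul ((hqb.mul hqb).mul hqb)
  have hfun : ∀ q b, edgeTerm q b = q⁻¹ * ((q + b) * (q + b) * (q + b)) := fun q b => by
    rw [edgeTerm]
    ring
  simp only [hfun]
  refine h.of_eq ?_ ?_ ?_ <;> field_simp <;> ring

/-- Expansion of a vertex term when the squared length is `X (1 + d₁ s + d₂ s²)` and the bias is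
`X (-t + β s)`. -/
theorem hasTwoJet_vertexTerm {X t d₁ d₂ β : ℝ} (hX : X ≠ 0) :
    HasTwoJet (fun s => vertexTerm (X * (1 + d₁ * s + d₂ * s ^ 2)) (X * (-t + β * s)))
      (X ^ 2 * ((1 - t) ^ 3 - (t ^ 3 + 2 - 3 * t) / X) + 1)
      (X ^ 2 * ((2 - 3 * t + t ^ 3 + (2 * t ^ 3 - 2) / X) * d₁
        + (3 - 6 * t + 3 * t ^ 2 + (3 * t ^ 2 - 3) / X) * β))
      (X ^ 2 * ((2 - 3 * t + t ^ 3 + (2 * t ^ 3 - 2) / X) * d₂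
        + (1 - t ^ 3 - 3 * t ^ 3 / X) * d₁ ^ 2
        + (3 - 3 * t ^ 2 - 6 * t ^ 2 / X) * (d₁ * β) + (3 - 3 * t - 3 * t / X) * β ^ 2)) := by
  have hq := (hasTwoJet_quadratic 1 d₁ d₂).const_mul X
  have hb : HasTwoJet (fun s => X * (-t + β * s)) (X * -t) (X * β) 0 := by
    simpa using (hasTwoJet_quadratic (-t) β 0).const_mul X
  have hi := hq.inv (mul_ne_zero hX one_ne_zero)
  have hbb := (hb.mul hb).mul hb
  have h1q := (hasTwoJet_const 1).add (hq.const_mul (-1))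
  have h := ((hbb.mul (hi.mul hi)).add (hbb.mul hi)).add
    (((h1q.mul h1q).add ((h1q.mul hb).const_mul (-3))).add ((hb.mul hb).const_mul 3))
  have hfun : ∀ q b, vertexTerm q b = b * b * b * (q⁻¹ * q⁻¹) + b * b * b * q⁻¹ +
      ((1 + -1 * q) * (1 + -1 * q) + -3 * ((1 + -1 * q) * b) + 3 * (b * b)) := fun q b => by
    rw [vertexTerm]
    ring
  simp only [hfun]
  refine h.of_eq ?_ ?_ ?_ <;> field_simp <;> ring

end Jets

/-! ### Coordinates rotating with the pentagon -/

section Frame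

/-- The unit vectors `(C k, S k)` of a regular pentagon: each is the previous one rotated by the
angle with cosine `κ` and sine `σ`. -/
structure IsPentagonFrame (κ σ : ℝ) (C S : Fin 5 → ℝ) : Prop where
  cos_step : ∀ k, C (k + 1) = κ * C k - σ * S k
  sin_step : ∀ k, S (k + 1) = κ * S k + σ * C k
  norm_sq : ∀ k, C k ^ 2 + S k ^ 2 = 1

/-- Coordinates of a direction `v` adapted to a pentagon of radius `l`: radial and tangential
components `ρ k`, `τ k` of the displacement of the column `k` in units of `l`, bias increments
`β k` in units of `l²`, the displacement `(p₀, p₁)` of the sixth column in units of `l`, and the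
increment `β₆` of the sixth bias. -/
structure IsFrameCoord (l : ℝ) (C S : Fin 5 → ℝ) (v : Param 2 6) (ρ τ β : Fin 5 → ℝ)
    (p₀ p₁ β₆ : ℝ) : Prop where
  weight_zero : ∀ k : Fin 5, weight v 0 k.castSucc = l * (ρ k * C k - τ k * S k)
  weight_one : ∀ k : Fin 5, weight v 1 k.castSucc = l * (ρ k * S k + τ k * C k)
  bias_eq : ∀ k : Fin 5, bias v k.castSucc = l ^ 2 * β k
  last_zero : weight v 0 (Fin.last 5) = l * p₀
  last_one : weight v 1 (Fin.last 5) = l * p₁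
  last_bias : bias v (Fin.last 5) = β₆

theorem IsPentagonFrame.exists_coord {κ σ l : ℝ} {C S : Fin 5 → ℝ} (h : IsPentagonFrame κ σ C S)
    (hl : l ≠ 0) (v : Param 2 6) : ∃ ρ τ β p₀ p₁ β₆, IsFrameCoord l C S v ρ τ β p₀ p₁ β₆ := by
  refine ⟨fun k => (C k * weight v 0 k.castSucc + S k * weight v 1 k.castSucc) / l,
    fun k => (-S k * weight v 0 k.castSucc + C k * weight v 1 k.castSucc) / l,
    fun k => bias v k.castSucc / l ^ 2, weight v 0 (Fin.last 5) / l, weight v 1 (Fin.last 5) / l,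
    bias v (Fin.last 5), fun k => ?_, fun k => ?_, fun k => ?_, ?_, ?_, rfl⟩
  · have := h.norm_sq k
    field_simp
    linear_combination -weight v 0 k.castSucc * this
  · have := h.norm_sq k
    field_simp
    linear_combination -weight v 1 k.castSucc * this
  all_goals field_simp

theorem IsFivePlusGon.exists_frame {x y : ℝ} {w : Param 2 6} (h : IsFivePlusGon x y w) :
    ∃ C S, IsPentagonFrame (cos (2 * π / 5)) (sin (2 * π / 5)) C S ∧
      ∀ k : Fin 5, weight w 0 k.castSucc = x * C k ∧ weight w 1 k.castSucc = x * S k := by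
  obtain ⟨⟨φ, hφ⟩, -⟩ := h
  have hstep : ∀ k : Fin 5,
      φ + 2 * π * ((k + 1 : Fin 5) : ℝ) / 5 = φ + 2 * π * (k : ℝ) / 5 + 2 * π / 5 ∨
      φ + 2 * π * ((k + 1 : Fin 5) : ℝ) / 5 = φ + 2 * π * (k : ℝ) / 5 + 2 * π / 5 - 2 * π := by
    intro k
    fin_cases k
    on_goal 5 => right
    any_goals left
    all_goals
      simp
      try ring
  refine ⟨fun k => cos (φ + 2 * π * (k : ℝ) / 5), fun k => sin (φ + 2 * π * (k : ℝ) / 5),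
    ⟨fun k => ?_, fun k => ?_, fun k => by rw [add_comm, sin_sq_add_cos_sq]⟩, hφ⟩
  · rw [mul_comm (cos (2 * π / 5)), mul_comm (sin (2 * π / 5)), ← cos_add]
    rcases hstep k with h | h
    · rw [h]
    · rw [h, cos_sub_two_pi]
  · rw [mul_comm (cos (2 * π / 5)), mul_comm (sin (2 * π / 5)), ← sin_add]
    rcases hstep k with h | h
    · rw [h]
    · rw [h, sin_sub_two_pi]

variable {κ σ : ℝ} {C S : Fin 5 → ℝ}

/-- A fixed vector, in a frame that rotates with the pentagon, has components of mean zero: the sums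
of the two components form a vector fixed by a nontrivial rotation. -/
theorem sum_rotating_eq_zero {a b : Fin 5 → ℝ} (hκσ : κ ^ 2 + σ ^ 2 = 1) (hκ : κ ≠ 1)
    (ha : ∀ k, a (k + 1) = κ * a k + σ * b k) (hb : ∀ k, b (k + 1) = κ * b k - σ * a k) :
    ∑ k, a k = 0 := by
  have h1 := sum_fin_five_shift 1 a
  have h2 := sum_fin_five_shift 1 b
  simp only [ha, hb, Finset.sum_add_distrib, Finset.sum_sub_distrib, ← Finset.mul_sum] at h1 h2
  have h3 : (2 * (1 - κ)) * ∑ k, a k = 0 := by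
    linear_combination (κ - 1) * h1 + (-σ) * h2 - (∑ k, a k) * hκσ
  exact (mul_eq_zero.1 h3).resolve_left (by
    intro h
    exact hκ (by linarith))

/-- The analogue for the traceless quadratic components `a² - b²` and `2 a b`, which rotate by twice
the angle; this rotation is nontrivial as `σ ≠ 0`. -/
theorem sum_sq_rotating_eq {a b : Fin 5 → ℝ} (hκσ : κ ^ 2 + σ ^ 2 = 1) (hσ : σ ≠ 0)
    (ha : ∀ k, a (k + 1) = κ * a k + σ * b k) (hb : ∀ k, b (k + 1) = κ * b k - σ * a k) :
    ∑ k, a k ^ 2 = ∑ k, b k ^ 2 := by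
  have h1 := sum_fin_five_shift 1 fun k => a k ^ 2
  have h2 := sum_fin_five_shift 1 fun k => a k * b k
  have e1 : ∀ k, (κ * a k + σ * b k) ^ 2 =
      κ ^ 2 * a k ^ 2 + 2 * κ * σ * (a k * b k) + σ ^ 2 * b k ^ 2 := fun k => by ring
  have e2 : ∀ k, (κ * a k + σ * b k) * (κ * b k - σ * a k) =
      (κ ^ 2 - σ ^ 2) * (a k * b k) + κ * σ * b k ^ 2 - κ * σ * a k ^ 2 := fun k => by ring
  simp only [ha, hb, e1, e2, Finset.sum_add_distrib, Finset.sum_sub_distrib,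
    ← Finset.mul_sum] at h1 h2
  set A := ∑ k, a k ^ 2
  set B := ∑ k, b k ^ 2
  set M := ∑ k, a k * b k
  have h3 : σ * (σ * (A - B) - 2 * κ * M) = 0 := by linear_combination -h1 + A * hκσ
  have h4 : σ * (2 * σ * M + κ * (A - B)) = 0 := by linear_combination -h2 + M * hκσ
  have h3' := (mul_eq_zero.1 h3).resolve_left hσ
  have h4' := (mul_eq_zero.1 h4).resolve_left hσ
  linear_combination σ * h3' + κ * h4' - (A - B) * hκσ

end Frame

/-! ### Second-order expansion at the pentagon -/

section Expansion

variable {κ σ l t : ℝ} {C S : Fin 5 → ℝ} {w v : Param 2 6} {ρ τ β : Fin 5 → ℝ} {p₀ p₁ β₆ : ℝ}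

/-- A regular pentagon of radius `l` and bias `-t l²` with a sixth column `0` of bias `1/12`. -/
structure IsFramedGon (κ σ l t : ℝ) (C S : Fin 5 → ℝ) (w : Param 2 6) : Prop where
  frame : IsPentagonFrame κ σ C S
  coord : IsFrameCoord l C S w 1 0 (fun _ => -t) 0 0 (1 / 12)

theorem IsFramedGon.inPentagonChamber (h : IsFramedGon κ σ l t C S w) (hl : l ≠ 0) (ht : 0 < t)
    (htκ : t < κ) (hκ1 : κ < 1) (hκσ : κ ^ 2 + σ ^ 2 = 1) (hκ2 : 2 * κ ^ 2 < 1) :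
    InPentagonChamber w := by
  obtain ⟨⟨hC, hS, hn⟩, ⟨h0, h1, hb, hl0, hl1, hlb⟩⟩ := h
  have hX : 0 < l ^ 2 := by positivity
  have hb' : ∀ k : Fin 5, bias w k.castSucc = l ^ 2 * -t := hb
  have hd0 : ∀ k : Fin 5, colDot w k.castSucc k.castSucc = l ^ 2 := fun k => by
    simp only [colDot, Fin.sum_univ_two, h0, h1, Pi.one_apply, Pi.zero_apply]
    linear_combination l ^ 2 * hn k
  have hd1 : ∀ k : Fin 5, colDot w k.castSucc (k + 1).castSucc = l ^ 2 * κ := fun k => by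
    simp only [colDot, Fin.sum_univ_two, h0, h1, Pi.one_apply, Pi.zero_apply, hC, hS]
    linear_combination l ^ 2 * κ * hn k
  have hd2 : ∀ k : Fin 5, colDot w k.castSucc (k + 2).castSucc = l ^ 2 * (2 * κ ^ 2 - 1) :=
      fun k => by
    have hk : k + 2 = k + 1 + 1 := by rw [add_assoc]; rfl
    simp only [hk, colDot, Fin.sum_univ_two, h0, h1, Pi.one_apply, Pi.zero_apply, hC, hS]
    linear_combination l ^ 2 * (2 * κ ^ 2 - 1) * hn k - l ^ 2 * (C k ^ 2 + S k ^ 2) * hκσ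
  have hd5 : ∀ k : Fin 5, colDot w (Fin.last 5) k.castSucc = 0 := fun k => by
    rw [colDot, Fin.sum_univ_two, hl0, hl1]
    ring
  have hd5' : ∀ k : Fin 5, colDot w k.castSucc (Fin.last 5) = 0 := fun k => by
    rw [colDot_comm, hd5]
  constructor
  · intro k
    rw [hb']
    nlinarith
  · intro k
    rw [hd1]
    nlinarith
  · intro k
    rw [hd1, hb']
    nlinarith
  · intro k
    rw [hd1, hb']
    nlinarith
  · intro k
    rw [hd2]
    nlinarith
  · intro k
    rw [hd0]
    exact hX
  · intro k
    rw [hd0, hb']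
    nlinarith
  · intro k
    rw [hd5', hb']
    nlinarith
  · rw [hlb]
    norm_num
  · intro k
    rw [hd5, hlb]
    norm_num

theorem weight_add_smul (w v : Param 2 6) (s : ℝ) (a : Fin 2) (i : Fin 6) :
    weight (w + s • v) a i = weight w a i + s * weight v a i := rfl

theorem bias_add_smul (w v : Param 2 6) (s : ℝ) (i : Fin 6) :
    bias (w + s • v) i = bias w i + s * bias v i := rfl

theorem IsFramedGon.colDot_edge (h : IsFramedGon κ σ l t C S w)
    (hv : IsFrameCoord l C S v ρ τ β p₀ p₁ β₆) (s : ℝ) (k : Fin 5) :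
    colDot (w + s • v) k.castSucc (k + 1).castSucc =
      l ^ 2 * (κ + (κ * (ρ k + ρ (k + 1)) + σ * (τ k - τ (k + 1))) * s
        + (κ * (ρ k * ρ (k + 1) + τ k * τ (k + 1)) + σ * (τ k * ρ (k + 1) - ρ k * τ (k + 1)))
          * s ^ 2) := by
  simp only [colDot, Fin.sum_univ_two, weight_add_smul, h.coord.weight_zero, h.coord.weight_one,
    hv.weight_zero, hv.weight_one, Pi.one_apply, Pi.zero_apply, h.frame.cos_step,
    h.frame.sin_step]
  linear_combination l ^ 2 * (κ + (κ * (ρ k + ρ (k + 1)) + σ * (τ k - τ (k + 1))) * s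
        + (κ * (ρ k * ρ (k + 1) + τ k * τ (k + 1)) + σ * (τ k * ρ (k + 1) - ρ k * τ (k + 1)))
          * s ^ 2) * h.frame.norm_sq k

theorem IsFramedGon.colDot_self (h : IsFramedGon κ σ l t C S w)
    (hv : IsFrameCoord l C S v ρ τ β p₀ p₁ β₆) (s : ℝ) (k : Fin 5) :
    colDot (w + s • v) k.castSucc k.castSucc =
      l ^ 2 * (1 + 2 * ρ k * s + (ρ k ^ 2 + τ k ^ 2) * s ^ 2) := by
  simp only [colDot, Fin.sum_univ_two, weight_add_smul, h.coord.weight_zero, h.coord.weight_one,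
    hv.weight_zero, hv.weight_one, Pi.one_apply, Pi.zero_apply]
  linear_combination l ^ 2 * (1 + 2 * ρ k * s + (ρ k ^ 2 + τ k ^ 2) * s ^ 2) * h.frame.norm_sq k

theorem IsFramedGon.colDot_last (h : IsFramedGon κ σ l t C S w)
    (hv : IsFrameCoord l C S v ρ τ β p₀ p₁ β₆) (s : ℝ) (k : Fin 5) :
    colDot (w + s • v) (Fin.last 5) k.castSucc =
      l ^ 2 * (0 + (p₀ * C k + p₁ * S k) * s
        + ((p₀ * C k + p₁ * S k) * ρ k + (p₁ * C k - p₀ * S k) * τ k) * s ^ 2) := by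
  simp only [colDot, Fin.sum_univ_two, weight_add_smul, h.coord.weight_zero, h.coord.weight_one,
    hv.weight_zero, hv.weight_one, Pi.one_apply, Pi.zero_apply, h.coord.last_zero,
    h.coord.last_one, hv.last_zero, hv.last_one]
  ring

theorem IsFramedGon.colDot_last_last (h : IsFramedGon κ σ l t C S w)
    (hv : IsFrameCoord l C S v ρ τ β p₀ p₁ β₆) (s : ℝ) :
    colDot (w + s • v) (Fin.last 5) (Fin.last 5) =
      l ^ 2 * (0 + 0 * s + (p₀ ^ 2 + p₁ ^ 2) * s ^ 2) := by
  simp only [colDot, Fin.sum_univ_two, weight_add_smul, h.coord.last_zero,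
    h.coord.last_one, hv.last_zero, hv.last_one]
  ring

theorem IsFramedGon.bias_castSucc (h : IsFramedGon κ σ l t C S w)
    (hv : IsFrameCoord l C S v ρ τ β p₀ p₁ β₆) (s : ℝ) (k : Fin 5) :
    bias (w + s • v) k.castSucc = l ^ 2 * (-t + β k * s) := by
  rw [bias_add_smul, h.coord.bias_eq, hv.bias_eq]
  ring

theorem IsFramedGon.bias_last (h : IsFramedGon κ σ l t C S w)
    (hv : IsFrameCoord l C S v ρ τ β p₀ p₁ β₆) (s : ℝ) :
    bias (w + s • v) (Fin.last 5) = 1 / 12 + β₆ * s + 0 * s ^ 2 := by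
  rw [bias_add_smul, h.coord.last_bias, hv.last_bias]
  ring

/-- Coefficients of the second-order expansion of the potential at the pentagon, in units of
`l⁴`. Those beginning with `e` come from the edges of the pentagon, those beginning with `v` from
its vertices; `eq` multiplies the second-order change of the dot product along an edge, the letters
`q` and `b` in the others stand for first-order changes of dot products and biases. The sixth
column contributes `m = 1 / l²`. -/
structure HessianCoeffs : Type where
  eq : ℝ
  eqq : ℝ
  eqb : ℝ
  ebb : ℝ
  vqq : ℝ
  vqb : ℝ
  vbb : ℝ
  m : ℝ

/-- The part of `hessianForm` that belongs to the vertex `k` and the edge from `k` to `k + 1`. -/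
noncomputable def hessianTerm (κ σ : ℝ) (c : HessianCoeffs) (ρ τ β a b : Fin 5 → ℝ) (k : Fin 5) :
    ℝ :=
  2 * c.eq * (κ * (ρ k * ρ (k + 1) + τ k * τ (k + 1))
      + σ * (τ k * ρ (k + 1) - ρ k * τ (k + 1)) - κ * (ρ k ^ 2 + τ k ^ 2))
    + 2 * c.eqq * (κ * (ρ k + ρ (k + 1)) + σ * (τ k - τ (k + 1))) ^ 2
    + c.eqb * (κ * (ρ k + ρ (k + 1)) + σ * (τ k - τ (k + 1))) * (β k + β (k + 1))
    + c.ebb * (β k ^ 2 + β (k + 1) ^ 2)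
    + 4 * c.vqq * ρ k ^ 2 + 2 * c.vqb * ρ k * β k + c.vbb * β k ^ 2
    + a k ^ 2 + c.m / 4 * (a k * ρ k + b k * τ k) - 7 / 20 * c.m * (a k ^ 2 + b k ^ 2)

/-- The quadratic part of the potential at the pentagon, except for the square of the increment of
the sixth bias. The sequences `a` and `b` are the components of the displacement of the sixth
column along the column `k` and orthogonally to it. -/
noncomputable def hessianForm (κ σ : ℝ) (c : HessianCoeffs) (ρ τ β a b : Fin 5 → ℝ) : ℝ :=
  ∑ k, hessianTerm κ σ c ρ τ β a b k

/-- The coefficients for cosine `κ`, bias ratio `t` and `m = 1 / l²`. -/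
noncomputable def hessianCoeffs (κ t m : ℝ) : HessianCoeffs where
  eq := 2 * κ - 3 * t + t ^ 3 / κ ^ 2
  eqq := 1 - t ^ 3 / κ ^ 3
  eqb := 3 - 3 * t ^ 2 / κ ^ 2
  ebb := 3 - 3 * t / κ
  vqq := 1 - t ^ 3 - 3 * t ^ 3 * m
  vqb := 3 - 3 * t ^ 2 - 6 * t ^ 2 * m
  vbb := 3 - 3 * t - 3 * t * m
  m := m

/-- Second-order expansion of the potential at the pentagon along a line. The hypotheses `hbias`
and `hlength` are the two stationarity equations; they make the linear term vanish. -/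
theorem IsFramedGon.hasTwoJet (h : IsFramedGon κ σ l t C S w)
    (hv : IsFrameCoord l C S v ρ τ β p₀ p₁ β₆) (hl : l ≠ 0) (hκ : κ ≠ 0) (hκ1 : κ ≠ 1)
    (hκσ : κ ^ 2 + σ ^ 2 = 1)
    (hbias : 2 * (3 * κ - 6 * t + 3 * t ^ 2 / κ)
      + (3 - 6 * t + 3 * t ^ 2 + (3 * t ^ 2 - 3) / l ^ 2) = 0)
    (hlength : 2 * κ * (2 * κ - 3 * t + t ^ 3 / κ ^ 2)
      + (2 - 3 * t + t ^ 3 + (2 * t ^ 3 - 2) / l ^ 2) = 0) :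
    ∃ a₀, HasTwoJet (fun s => localPotential (w + s • v)) a₀ 0
      (l ^ 4 * hessianForm κ σ (hessianCoeffs κ t (1 / l ^ 2)) ρ τ β
        (fun k => p₀ * C k + p₁ * S k) (fun k => p₁ * C k - p₀ * S k) + 18 * β₆ ^ 2) := by
  have hX : l ^ 2 ≠ 0 := pow_ne_zero 2 hl
  set X := l ^ 2 with hXdef
  have hX4 : l ^ 4 = X ^ 2 := by rw [hXdef]; ring
  set a : Fin 5 → ℝ := fun k => p₀ * C k + p₁ * S k with ha
  set b : Fin 5 → ℝ := fun k => p₁ * C k - p₀ * S k with hb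
  have hab : ∀ k, a k ^ 2 + b k ^ 2 = p₀ ^ 2 + p₁ ^ 2 := fun k => by
    simp only [ha, hb]
    linear_combination (p₀ ^ 2 + p₁ ^ 2) * h.frame.norm_sq k
  have hasum : ∑ k, a k = 0 := by
    refine sum_rotating_eq_zero (b := b) hκσ hκ1 (fun k => ?_) fun k => ?_
    · simp only [ha, hb, h.frame.cos_step, h.frame.sin_step]
      ring
    · simp only [ha, hb, h.frame.cos_step, h.frame.sin_step]
      ring
  have hB := hasTwoJet_quadratic (1 / 12) β₆ 0
  -- jets of the terms of the sixth column
  have hlast : ∀ k, _ := fun k : Fin 5 => (((hasTwoJet_quadratic 0 (a k)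
    (a k * ρ k + b k * τ k)).const_mul X).mul ((hasTwoJet_quadratic 0 (a k)
    (a k * ρ k + b k * τ k)).const_mul X)).add (((((hasTwoJet_quadratic 0 (a k)
    (a k * ρ k + b k * τ k)).const_mul X).mul hB).const_mul 3).add ((hB.mul hB).const_mul 3))
  have hR := (hasTwoJet_const 1).add
    (((hasTwoJet_quadratic 0 0 (p₀ ^ 2 + p₁ ^ 2)).const_mul X).const_mul (-1))
  have hself := ((hR.mul hR).add ((hR.mul hB).const_mul (-3))).add ((hB.mul hB).const_mul 3)
  have hsum := HasTwoJet.sum Finset.univ fun (k : Fin 5) _ =>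
    (((hasTwoJet_edgeTerm (t := t) (d₁ := κ * (ρ k + ρ (k + 1)) + σ * (τ k - τ (k + 1)))
      (d₂ := κ * (ρ k * ρ (k + 1) + τ k * τ (k + 1)) + σ * (τ k * ρ (k + 1) - ρ k * τ (k + 1)))
      (β := β k) hX hκ).add
    (hasTwoJet_edgeTerm (t := t) (d₁ := κ * (ρ k + ρ (k + 1)) + σ * (τ k - τ (k + 1)))
      (d₂ := κ * (ρ k * ρ (k + 1) + τ k * τ (k + 1)) + σ * (τ k * ρ (k + 1) - ρ k * τ (k + 1)))
      (β := β (k + 1)) hX hκ)).add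
    (hasTwoJet_vertexTerm (t := t) (d₁ := 2 * ρ k) (d₂ := ρ k ^ 2 + τ k ^ 2) (β := β k) hX)).add
      (hlast k)
  have htot := hsum.add hself
  refine ⟨_, (htot.congr fun s => ?_).of_eq rfl ?_ ?_⟩
  · rw [localPotential, selfTerm]
    simp only [h.colDot_edge hv, h.colDot_self hv, h.colDot_last hv, h.colDot_last_last hv,
      h.bias_castSucc hv, h.bias_last hv, ← hXdef]
    refine congrArg₂ (· + ·) (Finset.sum_congr rfl fun k _ => ?_) ?_
    · simp only [ha, hb]
      ring
    · ring
  · generalize 2 * κ - 3 * t + t ^ 3 / κ ^ 2 = gq at hlength ⊢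
    generalize 3 * κ - 6 * t + 3 * t ^ 2 / κ = gb at hbias ⊢
    generalize 2 - 3 * t + t ^ 3 + (2 * t ^ 3 - 2) / X = sq at hlength ⊢
    generalize 3 - 6 * t + 3 * t ^ 2 + (3 * t ^ 2 - 3) / X = sb at hbias ⊢
    -- the linear terms of the edges and vertices cancel up to the telescoping sequence `G`
    set G : Fin 5 → ℝ := fun k => X ^ 2 * (2 * gq * κ * ρ k - 2 * gq * σ * τ k + gb * β k)
    have hG := sum_fin_five_shift 1 G
    have hconst : ∑ _k : Fin 5, β₆ / 2 = 5 / 2 * β₆ := by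
      simp
      ring
    have hasum' : ∑ k, X / 4 * a k = 0 := by rw [← Finset.mul_sum, hasum, mul_zero]
    have hk : ∀ k, X ^ 2 * (gq * (κ * (ρ k + ρ (k + 1)) + σ * (τ k - τ (k + 1))) + gb * β k)
        + X ^ 2 * (gq * (κ * (ρ k + ρ (k + 1)) + σ * (τ k - τ (k + 1))) + gb * β (k + 1))
        + X ^ 2 * (sq * (2 * ρ k) + sb * β k) + X * a k / 4 =
        G (k + 1) - G k + X / 4 * a k := fun k => by
      simp only [G]
      linear_combination X ^ 2 * 2 * ρ k * hlength + X ^ 2 * β k * hbias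
    trans (∑ k, (G (k + 1) - G k + X / 4 * a k + β₆ / 2)) - 5 / 2 * β₆
    · refine congrArg₂ (· + ·) (Finset.sum_congr rfl fun k _ => ?_) ?_
      · linear_combination hk k
      · ring
    · rw [Finset.sum_add_distrib, Finset.sum_add_distrib, Finset.sum_sub_distrib, hG,
        hasum', hconst]
      ring
  · have hm : X * (1 / X) = 1 := by field_simp
    -- `p₀² + p₁²` is written as the mean of `a² + b²`, to distribute it over the pentagon
    have hextra : ∑ k, (7 / 20 * X * (a k ^ 2 + b k ^ 2) + 3 * X * β₆ * a k + 3 * β₆ ^ 2) =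
        7 / 4 * X * (p₀ ^ 2 + p₁ ^ 2) + 15 * β₆ ^ 2 := by
      simp only [hab]
      rw [Finset.sum_add_distrib, Finset.sum_add_distrib, ← Finset.mul_sum _ a, hasum]
      simp
      ring
    rw [hX4, hessianForm, Finset.mul_sum]
    trans (∑ k, (X ^ 2 * hessianTerm κ σ (hessianCoeffs κ t (1 / X)) ρ τ β a b k
      + (7 / 20 * X * (a k ^ 2 + b k ^ 2) + 3 * X * β₆ * a k + 3 * β₆ ^ 2)))
      + (-7 / 4 * X * (p₀ ^ 2 + p₁ ^ 2) + 3 * β₆ ^ 2)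
    · refine congrArg₂ (· + ·) (Finset.sum_congr rfl fun k _ => ?_) ?_
      · simp only [hessianTerm, hessianCoeffs]
        linear_combination X ^ 2 * (ρ k ^ 2 + τ k ^ 2) * hlength
          - X * ((a k * ρ k + b k * τ k) / 4 - 7 / 20 * (a k ^ 2 + b k ^ 2)) * hm
      · ring
    · rw [Finset.sum_add_distrib, hextra]
      ring

end Expansion

/-! ### Positivity of the Hessian transverse to the rotations -/

section Positivity

/-- The part of the Hessian on an edge that is symmetric under reversal of the edge, in terms of
the sums `S`, `B`, `Q` over the endpoints of `ρ`, `β`, `a` and the difference `D` of `τ`. -/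
noncomputable def symmetricEdgeForm (κ σ : ℝ) (c : HessianCoeffs) (S B D Q : ℝ) : ℝ :=
  (2 * c.eqq * κ ^ 2 + c.vqq) * S ^ 2 + (c.ebb / 2 + c.vbb / 4) * B ^ 2
    + (2 * c.eqq * σ ^ 2 - κ * c.eq) * D ^ 2 + (1 / 4 - 7 / 40 * c.m) * Q ^ 2
    + (c.eqb * κ + c.vqb / 2) * (S * B) + (4 * c.eqq * (κ * σ) + 2 * c.eq * σ) * (S * D)
    + c.eqb * σ * (B * D) + c.m / 16 * (S * Q) + c.m / (8 * σ) * (D * Q)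

/-- The part of the Hessian on an edge that is antisymmetric under reversal of the edge, in terms
of the differences `T`, `B`, `Q` over the endpoints of `ρ`, `β`, `a`. -/
noncomputable def antisymmetricEdgeForm (κ : ℝ) (c : HessianCoeffs) (T B Q : ℝ) : ℝ :=
  (c.vqq - κ * c.eq) * T ^ 2 + (c.ebb / 2 + c.vbb / 4) * B ^ 2 + (1 / 4 - 7 / 40 * c.m) * Q ^ 2
    + c.vqb / 2 * (T * B) + c.m / 16 * (T * Q)

variable {κ σ : ℝ}

/-- The Hessian splits over the edges of the pentagon: up to terms that telescope around it, and
to the difference of `∑ a²` and `∑ b²`, which vanishes, each summand is a form in the sums and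
differences over the endpoints of an edge. -/
theorem hessianForm_eq_sum_edgeForms {c : HessianCoeffs} {ρ τ β a b : Fin 5 → ℝ}
    (hκσ : κ ^ 2 + σ ^ 2 = 1) (hσ : σ ≠ 0) (ha : ∀ k, a (k + 1) = κ * a k + σ * b k)
    (hb : ∀ k, b (k + 1) = κ * b k - σ * a k) :
    hessianForm κ σ c ρ τ β a b = ∑ k,
      (symmetricEdgeForm κ σ c (ρ k + ρ (k + 1)) (β k + β (k + 1)) (τ k - τ (k + 1))
          (a k + a (k + 1))
        + antisymmetricEdgeForm κ c (ρ k - ρ (k + 1)) (β k - β (k + 1)) (a k - a (k + 1))) := by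
  set Ψ : Fin 5 → ℝ := fun k => c.eq * κ * (ρ k ^ 2 + τ k ^ 2) + 2 * c.eq * σ * (τ k * ρ k)
    - 2 * c.vqq * ρ k ^ 2 - c.vqb * (ρ k * β k) - c.vbb / 2 * β k ^ 2
    - (1 - 7 / 10 * c.m) / 2 * a k ^ 2 - c.m / 8 * (a k * ρ k)
    + c.m / (8 * σ) * (τ k * a k + τ k * (κ * a k - σ * b k)) with hΨ
  have h1 := sum_fin_five_shift 1 Ψ
  have h2 := sum_sq_rotating_eq hκσ hσ ha hb
  -- up to telescoping terms `2 σ τ b` equals `τ a⁺ - τ⁺ a`, where `⁺` is the next index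
  have key : ∀ k, hessianTerm κ σ c ρ τ β a b k =
      (symmetricEdgeForm κ σ c (ρ k + ρ (k + 1)) (β k + β (k + 1)) (τ k - τ (k + 1))
          (a k + a (k + 1))
        + antisymmetricEdgeForm κ c (ρ k - ρ (k + 1)) (β k - β (k + 1)) (a k - a (k + 1)))
      + (Ψ (k + 1) - Ψ k) + 7 / 20 * c.m * (a k ^ 2 - b k ^ 2) := fun k => by
    have e : κ * a (k + 1) - σ * b (k + 1) = a k := by
      rw [ha, hb]
      linear_combination a k * hκσ
    have e' : b k = (a (k + 1) - κ * a k) / σ := by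
      rw [ha]
      field_simp
      ring
    simp only [hΨ, e, hessianTerm, symmetricEdgeForm, antisymmetricEdgeForm, e']
    field_simp
    ring
  rw [hessianForm, Finset.sum_congr rfl fun k _ => key k]
  rw [Finset.sum_add_distrib, Finset.sum_add_distrib, Finset.sum_sub_distrib, h1,
    ← Finset.mul_sum, Finset.sum_sub_distrib, h2]
  ring

theorem mul_bounds {a x A b y B : ℝ} (ha : 0 ≤ a) (hb : 0 ≤ b) (hx : a ≤ x ∧ x ≤ A)
    (hy : b ≤ y ∧ y ≤ B) : a * b ≤ x * y ∧ x * y ≤ A * B :=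
  ⟨mul_le_mul hx.1 hy.1 hb (ha.trans hx.1),
    mul_le_mul hx.2 hy.2 (hb.trans hy.1) ((ha.trans hx.1).trans hx.2)⟩

/-- Replacing a coefficient `a` of a quadratic form by an approximation `o` costs at most a
multiple of the sum of squares. -/
theorem mul_mul_ge_of_abs_sub_le {a o η : ℝ} (h : |a - o| ≤ η) (x y : ℝ) :
    o * (x * y) - η / 2 * (x ^ 2 + y ^ 2) ≤ a * (x * y) := by
  have h1 : |(a - o) * (x * y)| ≤ η * ((x ^ 2 + y ^ 2) / 2) := by
    rw [abs_mul]
    refine mul_le_mul h ?_ (abs_nonneg _) ((abs_nonneg _).trans h)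
    rw [abs_le]
    constructor <;> nlinarith [sq_nonneg (x + y), sq_nonneg (x - y)]
  have := (abs_le.1 h1).1
  linarith

theorem mul_sq_ge_of_abs_sub_le {a o η : ℝ} (h : |a - o| ≤ η) (x : ℝ) :
    o * x ^ 2 - η * x ^ 2 ≤ a * x ^ 2 := by
  nlinarith [(abs_le.1 h).1, sq_nonneg x]

/-- Approximations of the coefficients of the edge forms that hold at the pentagon. -/
structure EdgeFormBounds (κ σ : ℝ) (c : HessianCoeffs) : Prop where
  ss : |2 * c.eqq * κ ^ 2 + c.vqq - 1.106| ≤ 0.001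
  bb : |c.ebb / 2 + c.vbb / 4 - 0.982| ≤ 0.001
  dd : |2 * c.eqq * σ ^ 2 - κ * c.eq - 1.244| ≤ 0.001
  pp : |1 / 4 - 7 / 40 * c.m - 0.122| ≤ 0.001
  sb : |c.eqb * κ + c.vqb / 2 - 1.858| ≤ 0.001
  sd : |4 * c.eqq * (κ * σ) + 2 * c.eq * σ - 1.001| ≤ 0.001
  bd : |c.eqb * σ - 1.584| ≤ 0.001
  sp : |c.m / 16 - 0.046| ≤ 0.001
  dp : |c.m / (8 * σ) - 0.096| ≤ 0.001
  tt : |c.vqq - κ * c.eq - 0.944| ≤ 0.001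
  tb : |c.vqb / 2 - 1.343| ≤ 0.001

theorem edgeFormBounds_of_bounds {c : HessianCoeffs} (hκ : 0.309016 ≤ κ ∧ κ ≤ 0.309017)
    (hσ : 0.95105 ≤ σ ∧ σ ≤ 0.95106) (hm : 0.72993 ≤ c.m ∧ c.m ≤ 0.72995)
    (heq : 0.09146 ≤ c.eq ∧ c.eq ≤ 0.0915) (heqq : 0.70346 ≤ c.eqq ∧ c.eqq ≤ 0.70352)
    (heqb : 1.666 ≤ c.eqb ∧ c.eqb ≤ 1.6661) (hebb : 0.9995 ≤ c.ebb ∧ c.ebb ≤ 0.9996)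
    (hvqq : 0.972 ≤ c.vqq ∧ c.vqq ≤ 0.9722) (hvqb : 2.6866 ≤ c.vqb ∧ c.vqb ≤ 2.6867)
    (hvbb : 1.9305 ≤ c.vbb ∧ c.vbb ≤ 1.9306) : EdgeFormBounds κ σ c := by
  have hκκ := mul_bounds (by norm_num) (by norm_num) hκ hκ
  have hσσ := mul_bounds (by norm_num) (by norm_num) hσ hσ
  have hκσ := mul_bounds (by norm_num) (by norm_num) hκ hσ
  have h1 := mul_bounds (by norm_num) (by norm_num) heqq hκκ
  have h2 := mul_bounds (by norm_num) (by norm_num) heqq hσσ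
  have h3 := mul_bounds (by norm_num) (by norm_num) heqq hκσ
  have h4 := mul_bounds (by norm_num) (by norm_num) hκ heq
  have h5 := mul_bounds (by norm_num) (by norm_num) heq hσ
  have h6 := mul_bounds (by norm_num) (by norm_num) heqb hκ
  have h7 := mul_bounds (by norm_num) (by norm_num) heqb hσ
  refine ⟨abs_le.2 ⟨?_, ?_⟩, abs_le.2 ⟨?_, ?_⟩, abs_le.2 ⟨?_, ?_⟩, abs_le.2 ⟨?_, ?_⟩,
    abs_le.2 ⟨?_, ?_⟩, abs_le.2 ⟨?_, ?_⟩, abs_le.2 ⟨?_, ?_⟩, abs_le.2 ⟨?_, ?_⟩, ?_,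
    abs_le.2 ⟨?_, ?_⟩, abs_le.2 ⟨?_, ?_⟩⟩
  · linarith [h1.1, hvqq.1]
  · linarith [h1.2, hvqq.2]
  · linarith [hebb.1, hvbb.1]
  · linarith [hebb.2, hvbb.2]
  · linarith [h2.1, h4.2]
  · linarith [h2.2, h4.1]
  · linarith [hm.2]
  · linarith [hm.1]
  · linarith [h6.1, hvqb.1]
  · linarith [h6.2, hvqb.2]
  · linarith [h3.1, h5.1]
  · linarith [h3.2, h5.2]
  · linarith [h7.1]
  · linarith [h7.2]
  · linarith [hm.1]
  · linarith [hm.2]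
  · have hσ0 : 0 < 8 * σ := by linarith [hσ.1]
    rw [abs_le, le_sub_iff_add_le, sub_le_iff_le_add, le_div_iff₀ hσ0, div_le_iff₀ hσ0]
    constructor <;> linarith [hσ.1, hσ.2, hm.1, hm.2]
  · linarith [hvqq.1, h4.2]
  · linarith [hvqq.2, h4.1]
  · linarith [hvqb.1]
  · linarith [hvqb.2]

theorem edgeFormBounds_hessianCoeffs {t m : ℝ} (hκ : 0.309016994374 < κ ∧ κ < 0.309016994375)
    (hσ : 0 < σ) (hκσ : κ ^ 2 + σ ^ 2 = 1) (ht : t ∈ Set.Icc (0.20606005 : ℝ) 0.20606006)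
    (hm : 0.72993 < m ∧ m < 0.72995) : EdgeFormBounds κ σ (hessianCoeffs κ t m) := by
  obtain ⟨hκ1, hκ2⟩ := hκ
  obtain ⟨ht1, ht2⟩ := ht
  have hκ0 : 0 < κ := by linarith
  have bκ : 0.309016 ≤ κ ∧ κ ≤ 0.309017 := ⟨by linarith, by linarith⟩
  have bσ : 0.95105 ≤ σ ∧ σ ≤ 0.95106 := by constructor <;> nlinarith
  have bx : 0.66682 ≤ t / κ ∧ t / κ ≤ 0.66683 := by
    rw [le_div_iff₀ hκ0, div_le_iff₀ hκ0]
    constructor <;> linarith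
  have bt : 0.20606 ≤ t ∧ t ≤ 0.20607 := ⟨by linarith, by linarith⟩
  have bm : 0.72993 ≤ m ∧ m ≤ 0.72995 := ⟨hm.1.le, hm.2.le⟩
  -- all coefficients are polynomials in `t`, `t / κ`, `κ` and `m`
  have e1 : t ^ 3 / κ ^ 2 = t / κ * (t / κ) * t := by field_simp
  have e2 : t ^ 3 / κ ^ 3 = t / κ * (t / κ) * (t / κ) := by field_simp
  have e3 : 3 * t ^ 2 / κ ^ 2 = 3 * (t / κ * (t / κ)) := by field_simp
  have e4 : 3 * t / κ = 3 * (t / κ) := by field_simp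
  have bxx := mul_bounds (by norm_num) (by norm_num) bx bx
  have bxxt := mul_bounds (by norm_num) (by norm_num) bxx bt
  have bxxx := mul_bounds (by norm_num) (by norm_num) bxx bx
  have btt := mul_bounds (by norm_num) (by norm_num) bt bt
  have bttt := mul_bounds (by norm_num) (by norm_num) btt bt
  have btm := mul_bounds (by norm_num) (by norm_num) bt bm
  have bttm := mul_bounds (by norm_num) (by norm_num) btt bm
  have btttm := mul_bounds (by norm_num) (by norm_num) bttt bm
  refine edgeFormBounds_of_bounds bκ bσ bm ⟨?_, ?_⟩ ⟨?_, ?_⟩ ⟨?_, ?_⟩ ⟨?_, ?_⟩ ⟨?_, ?_⟩ ⟨?_, ?_⟩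
    ⟨?_, ?_⟩ <;> simp only [hessianCoeffs, e1, e2, e3, e4]
  · linarith [bxxt.1]
  · linarith [bxxt.2]
  · linarith [bxxx.2]
  · linarith [bxxx.1]
  · linarith [bxx.2]
  · linarith [bxx.1]
  · linarith [bx.2]
  · linarith [bx.1]
  · linarith [bttt.2, btttm.2]
  · linarith [bttt.1, btttm.1]
  · linarith [btt.2, bttm.2]
  · linarith [btt.1, bttm.1]
  · linarith [bt.2, btm.2]
  · linarith [bt.1, btm.1]

theorem EdgeFormBounds.symmetricEdgeForm_ge {c : HessianCoeffs} (h : EdgeFormBounds κ σ c)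
    (S B D Q : ℝ) :
    (S ^ 2 + B ^ 2 + D ^ 2 + Q ^ 2) / 100 ≤ symmetricEdgeForm κ σ c S B D Q := by
  have h1 := mul_sq_ge_of_abs_sub_le h.ss S
  have h2 := mul_sq_ge_of_abs_sub_le h.bb B
  have h3 := mul_sq_ge_of_abs_sub_le h.dd D
  have h4 := mul_sq_ge_of_abs_sub_le h.pp Q
  have h5 := mul_mul_ge_of_abs_sub_le h.sb S B
  have h6 := mul_mul_ge_of_abs_sub_le h.sd S D
  have h7 := mul_mul_ge_of_abs_sub_le h.bd B D
  have h8 := mul_mul_ge_of_abs_sub_le h.sp S Q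
  have h9 := mul_mul_ge_of_abs_sub_le h.dp D Q
  -- successive completion of squares in the approximating form
  have h10 := sq_nonneg (S + 0.86 * B + 0.46 * D + 0.02 * Q)
  have h11 := sq_nonneg (B + 2.27 * D - 0.12 * Q)
  have h12 := sq_nonneg (D + 0.46 * Q)
  rw [symmetricEdgeForm]
  linarith [sq_nonneg S, sq_nonneg B, sq_nonneg D, sq_nonneg Q, sq_nonneg (S - B),
    sq_nonneg (S + D), sq_nonneg (S + Q), sq_nonneg (B + D), sq_nonneg (B + Q), sq_nonneg (D + Q)]

theorem EdgeFormBounds.antisymmetricEdgeForm_ge {c : HessianCoeffs} (h : EdgeFormBounds κ σ c)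
    (T B Q : ℝ) : (T ^ 2 + B ^ 2 + Q ^ 2) / 100 ≤ antisymmetricEdgeForm κ c T B Q := by
  have h1 := mul_sq_ge_of_abs_sub_le h.tt T
  have h2 := mul_sq_ge_of_abs_sub_le h.bb B
  have h3 := mul_sq_ge_of_abs_sub_le h.pp Q
  have h4 := mul_mul_ge_of_abs_sub_le h.tb T B
  have h5 := mul_mul_ge_of_abs_sub_le h.sp T Q
  -- successive completion of squares in the approximating form
  have h6 := sq_nonneg (T + 0.73 * B + 0.02 * Q)
  have h7 := sq_nonneg (B - 0.03 * Q)
  rw [antisymmetricEdgeForm]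
  linarith [sq_nonneg T, sq_nonneg B, sq_nonneg Q, sq_nonneg (T - B), sq_nonneg (T + Q),
    sq_nonneg (B + Q)]

/-- The Hessian bounds all coordinates except the common value of the `τ k`, which is the
coordinate along the rotation orbit. -/
theorem EdgeFormBounds.hessianForm_ge {c : HessianCoeffs} (h : EdgeFormBounds κ σ c)
    {ρ τ β a b : Fin 5 → ℝ} (hκσ : κ ^ 2 + σ ^ 2 = 1) (hσ : σ ≠ 0)
    (ha : ∀ k, a (k + 1) = κ * a k + σ * b k) (hb : ∀ k, b (k + 1) = κ * b k - σ * a k) :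
    ∑ k, (ρ k ^ 2 + β k ^ 2 + (τ k - τ (k + 1)) ^ 2 + a k ^ 2) ≤
      100 * hessianForm κ σ c ρ τ β a b := by
  rw [hessianForm_eq_sum_edgeForms hκσ hσ ha hb, Finset.mul_sum]
  refine Finset.sum_le_sum fun k _ => ?_
  have h1 := h.symmetricEdgeForm_ge (ρ k + ρ (k + 1)) (β k + β (k + 1)) (τ k - τ (k + 1))
    (a k + a (k + 1))
  have h2 := h.antisymmetricEdgeForm_ge (ρ k - ρ (k + 1)) (β k - β (k + 1)) (a k - a (k + 1))
  linarith [sq_nonneg (ρ k), sq_nonneg (ρ (k + 1)), sq_nonneg (β k), sq_nonneg (β (k + 1)),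
    sq_nonneg (a k), sq_nonneg (a (k + 1))]

end Positivity

/-! ### The Hessian matrix -/

section Hessian

variable {ι : Type*} [Fintype ι] [DecidableEq ι]

theorem dotProduct_hessian_mulVec (f : EuclideanSpace ℝ ι → ℝ) (w x y : EuclideanSpace ℝ ι) :
    x.ofLp ⬝ᵥ (hessian f w).mulVec y.ofLp = fderiv ℝ (fderiv ℝ f) w x y := by
  have hsum : ∀ z : EuclideanSpace ℝ ι, ∑ i, z.ofLp i • EuclideanSpace.single i (1 : ℝ) = z :=
    fun z => by
      have := (EuclideanSpace.basisFun ι ℝ).sum_repr z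
      simpa using this
  conv_rhs => rw [← hsum x, ← hsum y]
  simp only [map_sum, map_smul, _root_.sum_apply, _root_.smul_apply,
    dotProduct, Matrix.mulVec, hessian, Matrix.of_apply, smul_eq_mul, Finset.mul_sum]
  rw [Finset.sum_comm]
  refine Finset.sum_congr rfl fun i _ => Finset.sum_congr rfl fun j _ => ?_
  ring

theorem hessian_isHermitian {f : EuclideanSpace ℝ ι → ℝ} {w : EuclideanSpace ℝ ι}
    (hf : ContDiffAt ℝ 2 f w) : (hessian f w).IsHermitian := by
  refine Matrix.IsHermitian.ext fun i j => ?_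
  rw [hessian, Matrix.of_apply, Matrix.of_apply, star_trivial]
  exact (hf.isSymmSndFDerivAt (by simp)).eq _ _

end Hessian

/-! ### Critical points degenerate only along an orbit -/

/-- Local structure at a critical point `w` at which the second derivative is nonnegative and
degenerate only in the direction `τ` of a one-parameter group of symmetries. -/
theorem structure_of_degenerate_only_along_orbit {ι : Type} [Fintype ι] [DecidableEq ι]
    {f : EuclideanSpace ℝ ι → ℝ} {w τ : EuclideanSpace ℝ ι}
    (hf : ∀ᶠ x in 𝓝 w, ContDiffAt ℝ ∞ f x) (hf1 : fderiv ℝ f w = 0)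
    (hnonneg : ∀ v, 0 ≤ fderiv ℝ (fderiv ℝ f) w v v)
    (hzero : ∀ v, fderiv ℝ (fderiv ℝ f) w v v = 0 ↔ ∃ t : ℝ, v = t • τ) (hτ : τ ≠ 0)
    (R : ℝ → EuclideanSpace ℝ ι → EuclideanSpace ℝ ι)
    (hR : ContDiff ℝ ∞ fun p : ℝ × EuclideanSpace ℝ ι => R p.1 p.2) (hR0 : ∀ x, R 0 x = x)
    (hRf : ∀ t x, f (R t x) = f x) (hRτ : HasDerivAt (fun t => R t w) τ 0) :
    IsMinimallySingularAt f w ∧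
    (∃ hA : (hessian f w).IsHermitian,
      (∀ i, 0 ≤ hA.eigenvalues i) ∧ (∃! i, hA.eigenvalues i = 0)) ∧
    (∀ v : EuclideanSpace ℝ ι, (hessian f w).mulVec v.ofLp = 0 ↔ ∃ t : ℝ, v = t • τ) ∧
    HasLocalLearningCoefficient f w (((Fintype.card ι - 1 : ℕ) : ℝ) / 2) := by
  have hA := hessian_isHermitian (hf.self_of_nhds.of_le ENat.LEInfty.out)
  have hpos : (hessian f w).PosSemidef :=
    Matrix.PosSemidef.of_dotProduct_mulVec_nonneg hA fun x => by
      rw [star_trivial, dotProduct_hessian_mulVec f w (WithLp.toLp 2 x) (WithLp.toLp 2 x)]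
      exact hnonneg _
  have hker : ∀ v : EuclideanSpace ℝ ι,
      (hessian f w).mulVec v.ofLp = 0 ↔ ∃ t : ℝ, v = t • τ := fun v => by
    rw [← hpos.dotProduct_mulVec_zero_iff, star_trivial, dotProduct_hessian_mulVec, hzero]
  set v := hA.eigenvectorBasis with hv
  set μ := hA.eigenvalues with hμ
  have hform : ∀ x i, fderiv ℝ (fderiv ℝ f) w x (v i) = μ i * inner ℝ (v i) x := fun x i => by
    rw [← dotProduct_hessian_mulVec, hA.mulVec_eigenvectorBasis, dotProduct_smul,
      EuclideanSpace.inner_eq_star_dotProduct, star_trivial, smul_eq_mul]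
  have hτ0 : (hessian f w).mulVec τ.ofLp = 0 := (hker τ).2 ⟨1, (one_smul ℝ τ).symm⟩
  have hμτ : ∀ i, μ i * inner ℝ (v i) τ = 0 := fun i => by
    rw [← hform, (hf.self_of_nhds.isSymmSndFDerivAt
      (by simpa using ENat.LEInfty.out)).eq, ← dotProduct_hessian_mulVec,
      hτ0, dotProduct_zero]
  -- an eigenvector not orthogonal to `τ`; by `hμτ` its eigenvalue is `0`
  obtain ⟨i₀, hi₀⟩ : ∃ i, inner ℝ (v i) τ ≠ 0 := by
    by_contra! h
    refine hτ ?_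
    rw [← v.sum_repr τ]
    simp [v.repr_apply_apply, h]
  have hμ₀ : μ i₀ = 0 := (mul_eq_zero.1 (hμτ i₀)).resolve_right hi₀
  have hunique : ∀ i, μ i = 0 → i = i₀ := fun i hi => by
    by_contra hne
    obtain ⟨t, ht⟩ := (hker (v i)).1 (by rw [hA.mulVec_eigenvectorBasis, ← hμ, hi, zero_smul])
    have h1 : inner ℝ (v i₀) (v i) = 0 := v.orthonormal.2 (Ne.symm hne)
    rw [ht, inner_smul_right] at h1
    have ht0 := (mul_eq_zero.1 h1).resolve_right hi₀
    have h2 := v.orthonormal.1 i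
    rw [ht, ht0, zero_smul, norm_zero] at h2
    exact zero_ne_one h2
  have hμnonneg : ∀ i, 0 ≤ μ i := hpos.eigenvalues_nonneg
  obtain ⟨e, he, he0, hes, hes', hef⟩ := exists_chart_eq_sum_sq hf hf1 v μ i₀
    (fun i hi => (hμnonneg i).lt_of_ne fun h => hi (hunique i h.symm))
    (fun i j => by
      rw [hform, v.inner_eq_ite]
      rcases eq_or_ne i j with rfl | h
      · simp
      · simp [h, h.symm]) R hR hR0 hRf hRτ hi₀
  refine ⟨⟨e, he, he0, hes, hes', Finset.univ.erase i₀, fun _ => 1, ?_, fun _ _ => one_pos, ?_⟩,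
    ⟨hA, hμnonneg, i₀, hμ₀, hunique⟩, hker,
    hasLocalLearningCoefficient_of_chart e he he0 hes hes' i₀ hef⟩
  · exact fun h => Finset.notMem_erase i₀ Finset.univ (by rw [h]; exact Finset.mem_univ i₀)
  · simpa only [one_mul] using hef

/-! ### The rotation symmetry -/

section Rotation

/-- The rotation `(W, b) ↦ (R_t W, b)` of all columns by the angle `t`. -/
noncomputable def rotationFlow (t : ℝ) (w : Param 2 6) : Param 2 6 :=
  WithLp.toLp 2 (Sum.elim (fun p => ![cos t * weight w 0 p.2 - sin t * weight w 1 p.2,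
    sin t * weight w 0 p.2 + cos t * weight w 1 p.2] p.1) (bias w))

theorem weight_zero_rotationFlow (t : ℝ) (w : Param 2 6) (i : Fin 6) :
    weight (rotationFlow t w) 0 i = cos t * weight w 0 i - sin t * weight w 1 i := rfl

theorem weight_one_rotationFlow (t : ℝ) (w : Param 2 6) (i : Fin 6) :
    weight (rotationFlow t w) 1 i = sin t * weight w 0 i + cos t * weight w 1 i := rfl

theorem bias_rotationFlow (t : ℝ) (w : Param 2 6) (i : Fin 6) :
    bias (rotationFlow t w) i = bias w i := rfl

theorem param_ext {v w : Param 2 6} (h0 : ∀ i, weight v 0 i = weight w 0 i)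
    (h1 : ∀ i, weight v 1 i = weight w 1 i) (hb : ∀ i, bias v i = bias w i) : v = w := by
  ext (⟨a, i⟩ | i)
  · fin_cases a
    · exact h0 i
    · exact h1 i
  · exact hb i

theorem colDot_rotationFlow (t : ℝ) (w : Param 2 6) (i j : Fin 6) :
    colDot (rotationFlow t w) i j = colDot w i j := by
  simp only [colDot, Fin.sum_univ_two, weight_zero_rotationFlow, weight_one_rotationFlow]
  linear_combination (weight w 0 i * weight w 0 j + weight w 1 i * weight w 1 j) *
    cos_sq_add_sin_sq t

theorem potential_rotationFlow (t : ℝ) (w : Param 2 6) :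
    potential (rotationFlow t w) = potential w := by
  simp only [potential, potentialNeg, potentialPos, InPij, InPi, InQij, selfTerm,
    colDot_rotationFlow, bias_rotationFlow]
  -- only the decidability instances of the conditions differ
  congr! <;> exact congrArg (@ite ℝ _) (Subsingleton.elim _ _)

theorem rotationFlow_zero (w : Param 2 6) : rotationFlow 0 w = w :=
  param_ext (fun i => by simp [weight_zero_rotationFlow])
    (fun i => by simp [weight_one_rotationFlow]) fun _ => rfl

theorem contDiff_rotationFlow :
    ContDiff ℝ ∞ fun p : ℝ × Param 2 6 => rotationFlow p.1 p.2 := by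
  have hw : ∀ a i, ContDiff ℝ ∞ fun p : ℝ × Param 2 6 => weight p.2 a i := fun a i =>
    (contDiff_weight a i).comp contDiff_snd
  have hc : ContDiff ℝ ∞ fun p : ℝ × Param 2 6 => cos p.1 := contDiff_cos.comp contDiff_fst
  have hs : ContDiff ℝ ∞ fun p : ℝ × Param 2 6 => sin p.1 := contDiff_sin.comp contDiff_fst
  rw [contDiff_euclidean]
  rintro (⟨a, i⟩ | i)
  · fin_cases a
    · exact (hc.mul (hw 0 i)).sub (hs.mul (hw 1 i))
    · exact (hs.mul (hw 0 i)).add (hc.mul (hw 1 i))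
  · have hb : ContDiff ℝ ∞ fun p : ℝ × Param 2 6 => bias p.2 i :=
      (contDiff_bias i).comp contDiff_snd
    exact hb

theorem hasDerivAt_rotationFlow (w : Param 2 6) :
    HasDerivAt (fun t => rotationFlow t w) (rotationTangent w) 0 := by
  set u : Param 2 6 := WithLp.toLp 2 (Sum.elim (fun p => weight w p.1 p.2) fun _ => 0) with hu
  have h : ∀ t, rotationFlow t w = w + ((cos t - 1) • u + sin t • rotationTangent w) := fun t => by
    refine param_ext (fun i => ?_) (fun i => ?_) fun i => ?_
    · change _ = weight w 0 i + ((cos t - 1) * weight w 0 i + sin t * -weight w 1 i)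
      rw [weight_zero_rotationFlow]
      ring
    · change _ = weight w 1 i + ((cos t - 1) * weight w 1 i + sin t * weight w 0 i)
      rw [weight_one_rotationFlow]
      ring
    · change _ = bias w i + ((cos t - 1) * 0 + sin t * 0)
      rw [bias_rotationFlow]
      ring
  simp only [h]
  have hd := ((((hasDerivAt_cos 0).sub_const 1).smul_const u).add
    ((hasDerivAt_sin 0).smul_const (rotationTangent w))).const_add w
  simpa using hd

end Rotation

/-! ### Second derivative of the potential at a pentagon -/

section Pentagon

variable {κ σ l t : ℝ} {C S : Fin 5 → ℝ} {w v : Param 2 6} {ρ τ β : Fin 5 → ℝ} {p₀ p₁ β₆ : ℝ}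

theorem IsFivePlusGon.exists_isFramedGon {x y t : ℝ} (h : IsFivePlusGon x y w)
    (hy : y = -t * x ^ 2) :
    ∃ C S, IsFramedGon (cos (2 * π / 5)) (sin (2 * π / 5)) x t C S w := by
  obtain ⟨C, S, hCS, hw⟩ := h.exists_frame
  obtain ⟨-, hlast, hb, hb6⟩ := h
  refine ⟨C, S, hCS, fun k => ?_, fun k => ?_, fun k => ?_, ?_, ?_, hb6⟩
  · rw [(hw k).1, Pi.one_apply, Pi.zero_apply]
    ring
  · rw [(hw k).2, Pi.one_apply, Pi.zero_apply]
    ring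
  · rw [hb, hy]
    ring
  · rw [hlast, mul_zero]
  · rw [hlast, mul_zero]

theorem IsFramedGon.isFrameCoord_smul_rotationTangent (h : IsFramedGon κ σ l t C S w) (s : ℝ) :
    IsFrameCoord l C S (s • rotationTangent w) 0 (fun _ => s) 0 0 0 0 := by
  have h0 : ∀ i, weight (s • rotationTangent w) 0 i = s * -weight w 1 i := fun _ => rfl
  have h1 : ∀ i, weight (s • rotationTangent w) 1 i = s * weight w 0 i := fun _ => rfl
  have hb : ∀ i, bias (s • rotationTangent w) i = s * 0 := fun _ => rfl
  refine ⟨fun k => ?_, fun k => ?_, fun k => ?_, ?_, ?_, ?_⟩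
  · rw [h0, h.coord.weight_one]
    simp
    ring
  · rw [h1, h.coord.weight_zero]
    simp
    ring
  · simp [hb]
  · rw [h0, h.coord.last_one]
    ring
  · rw [h1, h.coord.last_zero]
    ring
  · simp [hb]

theorem IsFrameCoord.ext {v' : Param 2 6} (h : IsFrameCoord l C S v ρ τ β p₀ p₁ β₆)
    (h' : IsFrameCoord l C S v' ρ τ β p₀ p₁ β₆) : v = v' := by
  refine param_ext (Fin.lastCases ?_ fun k => ?_) (Fin.lastCases ?_ fun k => ?_)
    (Fin.lastCases ?_ fun k => ?_)
  · rw [h.last_zero, h'.last_zero]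
  · rw [h.weight_zero, h'.weight_zero]
  · rw [h.last_one, h'.last_one]
  · rw [h.weight_one, h'.weight_one]
  · rw [h.last_bias, h'.last_bias]
  · rw [h.bias_eq, h'.bias_eq]

theorem eq_const_of_forall_eq_succ {f : Fin 5 → ℝ} (h : ∀ k, f k = f (k + 1)) :
    f = fun _ => f 0 := by
  have h0 : f 0 = f 1 := h 0
  have h1 : f 1 = f 2 := h 1
  have h2 : f 2 = f 3 := h 2
  have h3 : f 3 = f 4 := h 3
  funext k
  fin_cases k
  · rfl
  · exact h0.symm
  · exact (h0.trans h1).symm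
  · exact (h0.trans (h1.trans h2)).symm
  · exact (h0.trans (h1.trans (h2.trans h3))).symm

/-- If the second derivative vanishes in the direction `v`, then the bound on `hessianForm` forces
all coordinates of `v` to vanish except a common tangential displacement of the columns. -/
theorem IsFramedGon.eq_smul_rotationTangent (h : IsFramedGon κ σ l t C S w)
    (hv : IsFrameCoord l C S v ρ τ β p₀ p₁ 0) {c : HessianCoeffs} (hc : EdgeFormBounds κ σ c)
    (hκσ : κ ^ 2 + σ ^ 2 = 1) (hσ : σ ≠ 0)
    (h0 : hessianForm κ σ c ρ τ β (fun k => p₀ * C k + p₁ * S k)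
      (fun k => p₁ * C k - p₀ * S k) ≤ 0) :
    v = τ 0 • rotationTangent w := by
  set a : Fin 5 → ℝ := fun k => p₀ * C k + p₁ * S k with ha
  set b : Fin 5 → ℝ := fun k => p₁ * C k - p₀ * S k with hb
  have ha1 : ∀ k, a (k + 1) = κ * a k + σ * b k := fun k => by
    simp only [ha, hb, h.frame.cos_step, h.frame.sin_step]
    ring
  have hb1 : ∀ k, b (k + 1) = κ * b k - σ * a k := fun k => by
    simp only [ha, hb, h.frame.cos_step, h.frame.sin_step]
    ring
  have hge := hc.hessianForm_ge (ρ := ρ) (τ := τ) (β := β) hκσ hσ ha1 hb1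
  have hterm : ∀ k ∈ Finset.univ, 0 ≤ ρ k ^ 2 + β k ^ 2 + (τ k - τ (k + 1)) ^ 2 + a k ^ 2 :=
    fun k _ => by positivity
  have hsum := (Finset.sum_eq_zero_iff_of_nonneg hterm).1
    (le_antisymm (by linarith) (Finset.sum_nonneg hterm))
  have hρ : ρ = 0 := by
    funext k
    have := hsum k (Finset.mem_univ k)
    exact pow_eq_zero_iff two_ne_zero |>.1 (by
      linarith [sq_nonneg (ρ k), sq_nonneg (β k), sq_nonneg (τ k - τ (k + 1)), sq_nonneg (a k)])
  have hβ : β = 0 := by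
    funext k
    have := hsum k (Finset.mem_univ k)
    exact pow_eq_zero_iff two_ne_zero |>.1 (by
      linarith [sq_nonneg (ρ k), sq_nonneg (β k), sq_nonneg (τ k - τ (k + 1)), sq_nonneg (a k)])
  have hτ : ∀ k, τ k = τ (k + 1) := fun k => by
    have := hsum k (Finset.mem_univ k)
    exact sub_eq_zero.1 (pow_eq_zero_iff two_ne_zero |>.1 (by
      linarith [sq_nonneg (ρ k), sq_nonneg (β k), sq_nonneg (τ k - τ (k + 1)), sq_nonneg (a k)]))
  have haz : ∀ k, a k ^ 2 = 0 := fun k => by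
    have := hsum k (Finset.mem_univ k)
    linarith [sq_nonneg (ρ k), sq_nonneg (β k), sq_nonneg (τ k - τ (k + 1)), sq_nonneg (a k)]
  have hbz : b 0 ^ 2 = 0 := by
    have hsq := sum_sq_rotating_eq hκσ hσ ha1 hb1
    simp only [haz, Finset.sum_const_zero] at hsq
    exact (Finset.sum_eq_zero_iff_of_nonneg fun k _ => sq_nonneg (b k)).1 hsq.symm 0
      (Finset.mem_univ 0)
  have ha0 : p₀ * C 0 + p₁ * S 0 = 0 := pow_eq_zero_iff two_ne_zero |>.1 (haz 0)
  have hb0 : p₁ * C 0 - p₀ * S 0 = 0 := pow_eq_zero_iff two_ne_zero |>.1 hbz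
  have hn := h.frame.norm_sq 0
  have hp₀ : p₀ = 0 := by linear_combination C 0 * ha0 - S 0 * hb0 - p₀ * hn
  have hp₁ : p₁ = 0 := by linear_combination S 0 * ha0 + C 0 * hb0 - p₁ * hn
  have hτ' := eq_const_of_forall_eq_succ hτ
  rw [hρ, hβ, hp₀, hp₁, hτ'] at hv
  exact hv.ext (h.isFrameCoord_smul_rotationTangent (τ 0))

theorem IsFramedGon.rotationTangent_ne_zero (h : IsFramedGon κ σ l t C S w) (hl : l ≠ 0) :
    rotationTangent w ≠ 0 := by
  intro h0
  have hcoord := h.isFrameCoord_smul_rotationTangent 1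
  rw [one_smul, h0] at hcoord
  have e0 : (0 : ℝ) = _ := hcoord.weight_zero 0
  have e1 : (0 : ℝ) = _ := hcoord.weight_one 0
  simp only [Pi.zero_apply] at e0 e1
  have hn := h.frame.norm_sq 0
  exact hl (by linear_combination (-l) * hn - C 0 * e1 + S 0 * e0)

end Pentagon

/-- The second-order behaviour of the potential at a `5⁺`-gon. -/
theorem IsPentagonSolution.potential_structure {x y : ℝ} (hxy : IsPentagonSolution x y)
    {w : Param 2 6} (hw : IsFivePlusGon x y w) :
    (∀ᶠ v in 𝓝 w, ContDiffAt ℝ ∞ (potential (r := 2) (c := 6)) v) ∧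
    fderiv ℝ (potential (r := 2) (c := 6)) w = 0 ∧
    (∀ v, 0 ≤ fderiv ℝ (fderiv ℝ (potential (r := 2) (c := 6))) w v v) ∧
    (∀ v, fderiv ℝ (fderiv ℝ (potential (r := 2) (c := 6))) w v v = 0 ↔
      ∃ t : ℝ, v = t • rotationTangent w) ∧
    rotationTangent w ≠ 0 := by
  obtain ⟨t, ht, hy, -, hbias, hlength⟩ := hxy.ratio
  obtain ⟨C, S, h⟩ := hw.exists_isFramedGon hy
  have hx : x ≠ 0 := hxy.pos.ne'
  have hquad := cos_two_pi_div_five_quadratic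
  have hκb := cos_two_pi_div_five_bounds
  have hsinpos : 0 < sin (2 * π / 5) :=
    sin_pos_of_pos_of_lt_pi (by positivity) (by linarith [pi_pos])
  have hsq := sq_length_bounds ht hbias
  have hκσ := cos_sq_add_sin_sq (2 * π / 5)
  set κ := cos (2 * π / 5) with hκdef
  set σ := sin (2 * π / 5) with hσdef
  have hκ0 : 0 < κ := by linarith [hκb.1]
  have hinv : 1 / κ = 2 + 4 * κ := by
    rw [div_eq_iff hκ0.ne']
    linarith
  have hcham : InPentagonChamber w := h.inPentagonChamber hx (by linarith [ht.1])
    (by linarith [ht.2, hκb.1]) (by linarith [hκb.2]) hκσ (by nlinarith [hκb.1])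
  have hm : 0.72993 < 1 / x ^ 2 ∧ 1 / x ^ 2 < 0.72995 := by
    have hx2 : 0 < x ^ 2 := by positivity
    rw [lt_div_iff₀ hx2, div_lt_iff₀ hx2]
    constructor <;> linarith [hsq.1, hsq.2]
  have hbounds := edgeFormBounds_hessianCoeffs hκb hsinpos hκσ ht hm
  have hb1 : 2 * (3 * κ - 6 * t + 3 * t ^ 2 / κ)
      + (3 - 6 * t + 3 * t ^ 2 + (3 * t ^ 2 - 3) / x ^ 2) = 0 := by
    have e1 : (3 * t ^ 2 - 3) / x ^ 2 = -3 * biasCoeff κ t := by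
      rw [div_eq_iff (pow_ne_zero 2 hx)]
      linear_combination 3 * hbias
    rw [e1, biasCoeff]
    linear_combination 6 * t ^ 2 * hinv
  have hl1 : 2 * κ * (2 * κ - 3 * t + t ^ 3 / κ ^ 2)
      + (2 - 3 * t + t ^ 3 + (2 * t ^ 3 - 2) / x ^ 2) = 0 := by
    have e1 : (2 * t ^ 3 - 2) / x ^ 2 = -lengthCoeff κ t := by
      rw [div_eq_iff (pow_ne_zero 2 hx)]
      linear_combination hlength
    have e2 : t ^ 3 / κ ^ 2 = t ^ 3 * (1 / κ) ^ 2 := by ring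
    rw [e1, lengthCoeff, e2, hinv]
    linear_combination (1 + t ^ 3 * (4 + 8 * κ)) * hquad
  have hjet : ∀ v : Param 2 6, ∃ ρ τ β p₀ p₁ β₆, IsFrameCoord x C S v ρ τ β p₀ p₁ β₆ := fun v =>
    h.frame.exists_coord hx v
  have hderiv : ∀ (v : Param 2 6) (ρ τ β : Fin 5 → ℝ) (p₀ p₁ β₆ : ℝ),
      IsFrameCoord x C S v ρ τ β p₀ p₁ β₆ →
      fderiv ℝ (potential (r := 2) (c := 6)) w v = 0 ∧
      fderiv ℝ (fderiv ℝ (potential (r := 2) (c := 6))) w v v =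
        2 * (x ^ 4 * hessianForm κ σ (hessianCoeffs κ t (1 / x ^ 2)) ρ τ β
          (fun k => p₀ * C k + p₁ * S k) (fun k => p₁ * C k - p₀ * S k) + 18 * β₆ ^ 2) := by
    intro v ρ τ β p₀ p₁ β₆ hv
    obtain ⟨a₀, ha₀⟩ := h.hasTwoJet hv hx hκ0.ne' (by linarith [hκb.2]) hκσ hb1 hl1
    have heq := hcham.potential_eventuallyEq
    rw [heq.fderiv_eq, heq.fderiv.fderiv_eq]
    exact fderiv_of_hasTwoJet (hcham.contDiffAt_localPotential.of_le ENat.LEInfty.out) ha₀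
  have hx4 : 0 < x ^ 4 := by positivity
  have hnonneg : ∀ (v : Param 2 6) (ρ τ β : Fin 5 → ℝ) (p₀ p₁ β₆ : ℝ),
      IsFrameCoord x C S v ρ τ β p₀ p₁ β₆ →
      0 ≤ hessianForm κ σ (hessianCoeffs κ t (1 / x ^ 2)) ρ τ β
          (fun k => p₀ * C k + p₁ * S k) (fun k => p₁ * C k - p₀ * S k) := by
    intro v ρ τ β p₀ p₁ β₆ hv
    have hge := hbounds.hessianForm_ge (ρ := ρ) (τ := τ) (β := β)
      (a := fun k => p₀ * C k + p₁ * S k) (b := fun k => p₁ * C k - p₀ * S k) hκσ hsinpos.ne'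
      (fun k => by
        simp only [h.frame.cos_step, h.frame.sin_step]
        ring)
      fun k => by
        simp only [h.frame.cos_step, h.frame.sin_step]
        ring
    have : 0 ≤ ∑ k, (ρ k ^ 2 + β k ^ 2 + (τ k - τ (k + 1)) ^ 2
        + (fun k => p₀ * C k + p₁ * S k) k ^ 2) := Finset.sum_nonneg fun k _ => by positivity
    linarith
  refine ⟨hcham.eventually_contDiffAt, ?_, fun v => ?_, fun v => ⟨fun hv0 => ?_, ?_⟩,
    h.rotationTangent_ne_zero hx⟩
  · ext v
    obtain ⟨ρ, τ, β, p₀, p₁, β₆, hv⟩ := hjet v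
    exact (hderiv v ρ τ β p₀ p₁ β₆ hv).1
  · obtain ⟨ρ, τ, β, p₀, p₁, β₆, hv⟩ := hjet v
    have := hnonneg v ρ τ β p₀ p₁ β₆ hv
    rw [(hderiv v ρ τ β p₀ p₁ β₆ hv).2]
    positivity
  · obtain ⟨ρ, τ, β, p₀, p₁, β₆, hv⟩ := hjet v
    have h1 := mul_nonneg hx4.le (hnonneg v ρ τ β p₀ p₁ β₆ hv)
    rw [(hderiv v ρ τ β p₀ p₁ β₆ hv).2] at hv0
    have hβ₆ : β₆ = 0 := pow_eq_zero_iff two_ne_zero |>.1 (by linarith [sq_nonneg β₆])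
    subst hβ₆
    refine ⟨τ 0, h.eq_smul_rotationTangent hv hbounds hκσ hsinpos.ne' ?_⟩
    exact le_of_mul_le_mul_left (by linarith) hx4
  · rintro ⟨s, rfl⟩
    rw [(hderiv _ _ _ _ _ _ _ (h.isFrameCoord_smul_rotationTangent s)).2, hessianForm,
      Finset.sum_eq_zero fun k _ => by
        simp only [hessianTerm, Pi.zero_apply]
        ring]
    ring

end TMS

theorem mainTheorem7 :
    (∃! p : ℝ × ℝ, TMS.IsPentagonSolution p.1 p.2) ∧
    ∀ l b : ℝ, TMS.IsPentagonSolution l b →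
      |l - 1.17046| < 0.000005 ∧ |b - (-0.28230)| < 0.000005 ∧
      ∀ w : TMS.Param 2 6, TMS.IsFivePlusGon l b w →
        HasGradientAt (TMS.potential (r := 2) (c := 6)) 0 w ∧
        TMS.IsMinimallySingularAt (TMS.potential (r := 2) (c := 6)) w ∧
        ContDiffAt ℝ 2 (TMS.potential (r := 2) (c := 6)) w ∧
        (∃ hA : (TMS.hessian (TMS.potential (r := 2) (c := 6)) w).IsHermitian,
          (∀ i, 0 ≤ hA.eigenvalues i) ∧ (∃! i, hA.eigenvalues i = 0)) ∧
        (∀ v : TMS.Param 2 6,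
          (TMS.hessian (TMS.potential (r := 2) (c := 6)) w).mulVec v.ofLp = 0 ↔
            ∃ t : ℝ, v = t • TMS.rotationTangent w) ∧
        TMS.HasLocalLearningCoefficient (TMS.potential (r := 2) (c := 6)) w (17 / 2) := by
  refine ⟨TMS.existsUnique_isPentagonSolution, fun l b hlb =>
    ⟨hlb.bounds.1, hlb.bounds.2, fun w hw => ?_⟩⟩
  obtain ⟨hsmooth, hcrit, hnonneg, hzero, hne⟩ := hlb.potential_structure hw
  obtain ⟨hsing, heig, hker, hcoeff⟩ := TMS.structure_of_degenerate_only_along_orbit hsmooth hcrit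
    hnonneg hzero hne TMS.rotationFlow TMS.contDiff_rotationFlow TMS.rotationFlow_zero
    TMS.potential_rotationFlow (TMS.hasDerivAt_rotationFlow w)
  have hsmooth2 := hsmooth.self_of_nhds.of_le (ENat.LEInfty.out : 2 ≤ (∞ : WithTop ℕ∞))
  refine ⟨?_, hsing, hsmooth2, heig, hker, ?_⟩
  · have hd := (hsmooth2.differentiableAt (by norm_num)).hasGradientAt
    rwa [gradient, hcrit, map_zero] at hd
  · convert hcoeff using 1
    norm_num [Fintype.card_sum, Fintype.card_prod]
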